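/- Let $D\subset\mathbb R^3$ be a bounded, open and connected set with $C^2$-smooth boundary $\Gamma=\partial D$ and outward unit normal $\nu$, and let $\mathcal O\subset D$ be an open neighbourhood of $\Gamma$ in $D$ (that is, $U\cap D\subset\mathcal O\subset D$ for some open $U\supset\Gamma$). Let $N$ be a $3\times3$ complex symmetric matrix-valued function with $L^\infty(D)$ entries such that, for some constant $\alpha>0$ and almost every $x\in D$, $\overline\xi\cdot\mathrm{Re}(N(x))\,\xi\ge\alpha$ and $\overline\xi\cdot\mathrm{Im}(N(x))\,\xi\ge0$ for all $\xi\in\mathbb C^3$ with $|\xi|=1$, and such that $N=nI$ almost everywhere in $\mathcal O$ for a constant $n>0$, $n\ne1$. Let $\mathbf H_0(\mathrm{curl}^2,D)$ be the space of all $\mathbf u\in L^2(D)^3$ whose distributional $\mathrm{curl}\,\mathbf u$ and $\mathrm{curl}\,\mathrm{curl}\,\mathbf u$ are in $L^2(D)^3$ and whose tangential traces $\nu\times\mathbf u$ and $\nu\times\mathrm{curl}\,\mathbf u$ (defined weakly by Green's formula) vanish on $\Gamma$. Then there is a constant $\Lambda>0$ such that for every real $\lambda\ge\Lambda$ and every $k\in\mathbb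 C$ with $\lambda=-k^2$ (so $k$ is purely imaginary) the transmission eigenvalue problem has only the trivial solution: if $\mathbf E,\mathbf E_0\in L^2(D)^3$, $\mathbf E-\mathbf E_0\in\mathbf H_0(\mathrm{curl}^2,D)$ (which expresses the boundary conditions $\nu\times\mathbf E=\nu\times\mathbf E_0$ and $\nu\times\mathrm{curl}\,\mathbf E=\nu\times\mathrm{curl}\,\mathbf E_0$ on $\Gamma$) and $$\mathrm{curl}\,\mathrm{curl}\,\mathbf E-k^2N\mathbf E=0,\qquad \mathrm{curl}\,\mathrm{curl}\,\mathbf E_0-k^2\mathbf E_0=0\qquad\text{in } D$$ in the sense of distributions, then $\mathbf E=\mathbf E_0=0$ almost everywhere in $D$. -/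

import Mathlib

open MeasureTheory Matrix
open scoped ContDiff

noncomputable section

namespace MaxwellITE

/-- Three-dimensional Euclidean space. -/
abbrev E3 : Type := EuclideanSpace ℝ (Fin 3)

/-- Complex vectors with three components, with the Hermitian norm. -/
abbrev C3 : Type := EuclideanSpace ℂ (Fin 3)

/-- The bilinear dot product `a · b = a₀ b₀ + a₁ b₁ + a₂ b₂` (no conjugation). -/
def dot (a b : C3) : ℂ := ∑ i, a i * b i

/-- The action of a matrix on a complex vector. -/
def act (A : Matrix (Fin 3) (Fin 3) ℂ) (a : C3) : C3 := WithLp.toLp 2 (A *ᵥ a.ofLp)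

/-- The partial derivative `∂φᵢ / ∂xⱼ`. -/
def partialD (φ : E3 → C3) (j i : Fin 3) (x : E3) : ℂ :=
  (fderiv ℝ φ x (EuclideanSpace.single j 1)) i

/-- The classical curl of a (differentiable) complex vector field. -/
def curl (φ : E3 → C3) (x : E3) : C3 :=
  !₂[partialD φ 1 2 x - partialD φ 2 1 x,
     partialD φ 2 0 x - partialD φ 0 2 x,
     partialD φ 0 1 x - partialD φ 1 0 x]

/-- `D` has `C²`-smooth boundary: near every boundary point, `D` is the sublevel set `{ρ < 0}` of a
`C²` function `ρ` whose differential does not vanish at that point. -/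
def HasC2Boundary (D : Set E3) : Prop :=
  ∀ x ∈ frontier D, ∃ (U : Set E3) (ρ : E3 → ℝ), IsOpen U ∧ x ∈ U ∧ ContDiffOn ℝ 2 ρ U ∧
    fderiv ℝ ρ x ≠ 0 ∧ D ∩ U = {y ∈ U | ρ y < 0}

/-- `O` is an open neighbourhood of the boundary of `D` in `D`. -/
def IsBoundaryNhd (D O : Set E3) : Prop :=
  IsOpen O ∧ O ⊆ D ∧ ∃ U : Set E3, IsOpen U ∧ frontier D ⊆ U ∧ U ∩ D ⊆ O

/-- Square integrable complex vector fields on `D`. -/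
def MemL2 (D : Set E3) (u : E3 → C3) : Prop := MemLp u 2 (volume.restrict D)

/-- Smooth, compactly supported test fields on the whole space. -/
def IsTestField (φ : E3 → C3) : Prop := ContDiff ℝ ∞ φ ∧ HasCompactSupport φ

/-- Test fields on `D`: smooth with compact support contained in `D`. -/
def IsTestFieldIn (D : Set E3) (φ : E3 → C3) : Prop := IsTestField φ ∧ tsupport φ ⊆ D

/-- `w` is the distributional curl of `u` in `D` (for `u`, `w` in `L²(D)`). -/
def IsWeakCurl (D : Set E3) (u w : E3 → C3) : Prop :=
  ∀ φ : E3 → C3, IsTestFieldIn D φ →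
    ∫ x in D, dot (u x) (curl φ x) = ∫ x in D, dot (w x) (φ x)

/-- The tangential trace `γ_t u = ν × u` on the boundary of `D` of a field `u` with curl `w`, both
in `L²(D)`, as a functional on test fields up to the boundary, given by Green's formula
`⟨ν × u, φ⟩ = ∫_D (curl u · φ - u · curl φ)`. -/
def tangentialTrace (D : Set E3) (u w φ : E3 → C3) : ℂ :=
  (∫ x in D, dot (w x) (φ x)) - ∫ x in D, dot (u x) (curl φ x)

/-- The space `H₀(curl², D)`: `u`, `curl u =: w`, `curl curl u =: z` lie in `L²(D)`, and the
tangential traces of `u` and of `curl u` vanish. -/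
def MemH0Curl2 (D : Set E3) (u : E3 → C3) : Prop :=
  MemL2 D u ∧ ∃ w z : E3 → C3, MemL2 D w ∧ MemL2 D z ∧ IsWeakCurl D u w ∧ IsWeakCurl D w z ∧
    (∀ φ, IsTestField φ → tangentialTrace D u w φ = 0) ∧
    (∀ φ, IsTestField φ → tangentialTrace D w z φ = 0)

/-- `curl curl E - k² N E = 0` in `D` in the sense of distributions. -/
def SolvesMaxwell (D : Set E3) (N : E3 → Matrix (Fin 3) (Fin 3) ℂ) (k : ℂ) (E : E3 → C3) : Prop :=
  ∀ φ : E3 → C3, IsTestFieldIn D φ →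
    (∫ x in D, dot (E x) (curl (curl φ) x)) - k ^ 2 * ∫ x in D, dot (act (N x) (E x)) (φ x) = 0

/-- `(E, E₀)` solves the transmission eigenvalue problem with wave number `k`. The two boundary
conditions `ν × E = ν × E₀`, `ν × curl E = ν × curl E₀` are the two vanishing traces
in `E - E₀ ∈ H₀(curl², D)`. -/
structure SolvesTransmission (D : Set E3) (N : E3 → Matrix (Fin 3) (Fin 3) ℂ) (k : ℂ)
    (E E₀ : E3 → C3) : Prop where
  memL2 : MemL2 D E
  memL2_zero : MemL2 D E₀
  diff_mem : MemH0Curl2 D (fun x => E x - E₀ x)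
  maxwell : SolvesMaxwell D N k E
  maxwell_zero : SolvesMaxwell D (fun _ => 1) k E₀

/-- The real part `conj ξ · A ξ` of the sesquilinear form of a real matrix `A` at `ξ ∈ ℂ³`
(the form is real when `A` is symmetric). -/
def form (A : Matrix (Fin 3) (Fin 3) ℝ) (ξ : C3) : ℝ :=
  (star ξ.ofLp ⬝ᵥ (A.map (fun t : ℝ => (t : ℂ)) *ᵥ ξ.ofLp)).re

/-- The assumption on the index of refraction: `N` is a symmetric matrix function with `L^∞(D)`
entries, `conj ξ · Re N ξ ≥ α > 0` and `conj ξ · Im N ξ ≥ 0` for all unit vectors `ξ ∈ ℂ³` almost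
everywhere in `D`, and `N = n I` in `O` with a positive constant `n ≠ 1`. -/
structure IndexAssumption (D O : Set E3) (N : E3 → Matrix (Fin 3) (Fin 3) ℂ) : Prop where
  bounded : ∀ i j, MemLp (fun x => N x i j) ⊤ (volume.restrict D)
  symm : ∀ᵐ x ∂(volume.restrict D), (N x).IsSymm
  re_coercive : ∃ α : ℝ, 0 < α ∧ ∀ᵐ x ∂(volume.restrict D), ∀ ξ : C3, ‖ξ‖ = 1 →
    α ≤ form ((N x).map Complex.re) ξ
  im_nonneg : ∀ᵐ x ∂(volume.restrict D), ∀ ξ : C3, ‖ξ‖ = 1 →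
    0 ≤ form ((N x).map Complex.im) ξ
  const_near_boundary : ∃ n : ℝ, 0 < n ∧ n ≠ 1 ∧
    ∀ᵐ x ∂(volume.restrict O), N x = (n : ℂ) • (1 : Matrix (Fin 3) (Fin 3) ℂ)

end MaxwellITE

end

namespace MaxwellITE

open Filter Topology

/-! ### The bilinear product and complex conjugation on `ℂ³` -/

/-! Put u = E - E₀, p = N E, λ = -k² > 0, with all fields extended by zero outside D. The vanishing
traces make the extended u a field whose curl and double curl on the whole space are in L².
Subtracting the equations gives curl curl u = -λ(p - E₀) in D. Pairing the conjugated equation of E₀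
with u yields ∫ Ē₀·(E - p) = 0, and ∫ curl curl u · ū = ‖curl u‖² ≥ 0 yields Re ∫ (p - E₀)·ū ≤ 0
(`transmission_identities`).

If n > 1, the second relation minus the first has real integrand |u|² + (n - 1)|E|² in O; if n < 1,
their sum has real integrand at least α|u|² + (1 - n)|E₀|² in O. Off O the indefinite terms are
absorbed or estimated, so that u and the part of E (or E₀) in O are controlled by its part in D \ O,
with constants free of λ (`energy_estimate_of_one_lt`, `energy_estimate_of_lt_one`). Conversely, a
Caccioppoli estimate with a cutoff equal to 1 on D \ O bounds λ times the mass in D \ O by a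
constant times the total mass (`exists_interior_bound`, `massOn_diff_le`). For large λ the two
bounds force everything to vanish (`eq_zero_of_interior_small`).

The delicate point is testing the equation of E₀, which is only L² up to the boundary, with u. It
suffices to have test fields φ on D that tend to u in L² while curl curl φ stays bounded
(`bl_add_bl_eq_zero`). They come from mollifying u and pulling it back along x ↦ x - tX(x), with X
pointing inwards on the boundary, which moves the support into D (`exists_isTestFieldIn_approx`).
The double curl of the covariant pull-back involves only curl u and ∇ curl u, and since div curl u =
0 the latter is controlled in L² by curl curl u (`integral_grad_curl`). -/

/-- Componentwise complex conjugation. -/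
noncomputable def cj (a : C3) : C3 := WithLp.toLp 2 fun i => star (a i)

@[simp] theorem cj_apply (a : C3) (i : Fin 3) : cj a i = star (a i) := rfl

@[simp] theorem cj_cj (a : C3) : cj (cj a) = a := by ext i; simp

theorem norm_sq_eq_sum (a : C3) : ‖a‖ ^ 2 = ∑ i, ‖a i‖ ^ 2 := EuclideanSpace.norm_sq_eq a

@[simp] theorem norm_cj (a : C3) : ‖cj a‖ = ‖a‖ := by
  simp [EuclideanSpace.norm_eq]

@[simp] theorem cj_zero : cj 0 = 0 := by ext i; simp

theorem cj_add (a b : C3) : cj (a + b) = cj a + cj b := by ext i; simp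

theorem cj_sub (a b : C3) : cj (a - b) = cj a - cj b := by ext i; simp

theorem cj_real_smul (c : ℝ) (a : C3) : cj (c • a) = c • cj a := by ext i; simp

/-- Conjugation as a real-linear continuous map. -/
noncomputable def cjL : C3 →L[ℝ] C3 :=
  LinearMap.mkContinuous
    { toFun := cj, map_add' := cj_add, map_smul' := cj_real_smul } 1 (fun a => by simp)

@[simp] theorem cjL_apply (a : C3) : cjL a = cj a := rfl

theorem dot_eq (a b : C3) : dot a b = a 0 * b 0 + a 1 * b 1 + a 2 * b 2 := by
  simp [dot, Fin.sum_univ_three]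

theorem dot_comm (a b : C3) : dot a b = dot b a := by simp [dot_eq, mul_comm]

theorem dot_add_left (a b c : C3) : dot (a + b) c = dot a c + dot b c := by
  simp [dot_eq]; ring

theorem dot_add_right (a b c : C3) : dot a (b + c) = dot a b + dot a c := by
  simp [dot_eq]; ring

theorem dot_sub_left (a b c : C3) : dot (a - b) c = dot a c - dot b c := by
  simp [dot_eq]; ring

theorem dot_sub_right (a b c : C3) : dot a (b - c) = dot a b - dot a c := by
  simp [dot_eq]; ring

theorem dot_smul_left (r : ℂ) (a b : C3) : dot (r • a) b = r * dot a b := by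
  simp [dot_eq]; ring

theorem dot_smul_right (r : ℂ) (a b : C3) : dot a (r • b) = r * dot a b := by
  simp [dot_eq]; ring

theorem dot_real_smul_left (r : ℝ) (a b : C3) : dot (r • a) b = r • dot a b := by
  simp [dot_eq]; ring

theorem dot_real_smul_right (r : ℝ) (a b : C3) : dot a (r • b) = r • dot a b := by
  simp [dot_eq]; ring

@[simp] theorem dot_zero_left (b : C3) : dot 0 b = 0 := by simp [dot_eq]

@[simp] theorem dot_zero_right (a : C3) : dot a 0 = 0 := by simp [dot_eq]

theorem dot_cj_left (a b : C3) : dot (cj a) b = inner ℂ a b := by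
  simp [dot, PiLp.inner_apply, mul_comm]

theorem dot_cj_cj (a b : C3) : dot (cj a) (cj b) = star (dot a b) := by
  simp [dot_eq]

theorem norm_dot_le (a b : C3) : ‖dot a b‖ ≤ ‖a‖ * ‖b‖ := by
  have h := dot_cj_left (cj a) b
  rw [cj_cj] at h
  rw [h, ← norm_cj a]
  exact norm_inner_le_norm _ _

theorem dot_cj_self (a : C3) : dot a (cj a) = ((‖a‖ ^ 2 : ℝ) : ℂ) := by
  rw [dot_comm, dot_cj_left, inner_self_eq_norm_sq_to_K]; simp

/-- The bilinear product as a continuous bilinear map. -/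
noncomputable def dotL : C3 →L[ℝ] C3 →L[ℝ] ℂ :=
  LinearMap.mkContinuous₂
    (LinearMap.mk₂ ℝ dot dot_add_left dot_real_smul_left dot_add_right dot_real_smul_right) 1
    (fun a b => by simpa using norm_dot_le a b)

@[simp] theorem dotL_apply (a b : C3) : dotL a b = dot a b := rfl

theorem aestronglyMeasurable_dot {μ : Measure E3} {f g : E3 → C3} (hf : AEStronglyMeasurable f μ)
    (hg : AEStronglyMeasurable g μ) : AEStronglyMeasurable (fun x => dot (f x) (g x)) μ :=
  dotL.aestronglyMeasurable_comp₂ hf hg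

theorem eLpNorm_dot_le {f g : E3 → C3} (hf : MemLp f 2) (hg : MemLp g 2) :
    eLpNorm (fun x => dot (f x) (g x)) 1 ≤ eLpNorm f 2 * eLpNorm g 2 := by
  have := eLpNorm_le_eLpNorm_mul_eLpNorm_of_nnnorm (p := 2) (q := 2) (r := 1)
    hf.1 hg.1 dot 1 (by
      refine Eventually.of_forall fun x => ?_
      rw [← NNReal.coe_le_coe]
      simpa using norm_dot_le (f x) (g x))
  simpa using this

theorem integrable_dot {f g : E3 → C3} (hf : MemLp f 2) (hg : MemLp g 2) :
    Integrable (fun x => dot (f x) (g x)) := by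
  rw [← memLp_one_iff_integrable]
  exact ⟨aestronglyMeasurable_dot hf.1 hg.1,
    (eLpNorm_dot_le hf hg).trans_lt (ENNReal.mul_lt_top hf.2 hg.2)⟩

/-- The bilinear pairing of two fields on the whole space. -/
noncomputable def bl (f g : E3 → C3) : ℂ := ∫ x, dot (f x) (g x)

/-- The `L²` norm on the whole space. -/
noncomputable def nrm (f : E3 → C3) : ℝ := (eLpNorm f 2).toReal

theorem nrm_nonneg (f : E3 → C3) : 0 ≤ nrm f := ENNReal.toReal_nonneg

theorem norm_bl_le {f g : E3 → C3} (hf : MemLp f 2) (hg : MemLp g 2) :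
    ‖bl f g‖ ≤ nrm f * nrm g := by
  have h1 := enorm_integral_le_lintegral_enorm (μ := volume) (fun x => dot (f x) (g x))
  rw [← eLpNorm_one_eq_lintegral_enorm] at h1
  have h2 := h1.trans (eLpNorm_dot_le hf hg)
  have h3 := ENNReal.toReal_mono (ENNReal.mul_lt_top hf.2 hg.2).ne h2
  rwa [ENNReal.toReal_mul, toReal_enorm] at h3

theorem bl_comm (f g : E3 → C3) : bl f g = bl g f := by simp only [bl, dot_comm]

theorem bl_sub_left {f g h : E3 → C3} (hf : MemLp f 2) (hg : MemLp g 2) (hh : MemLp h 2) :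
    bl (f - g) h = bl f h - bl g h := by
  simp only [bl, Pi.sub_apply, dot_sub_left]
  exact integral_sub (integrable_dot hf hh) (integrable_dot hg hh)

theorem bl_sub_right {f g h : E3 → C3} (hf : MemLp f 2) (hg : MemLp g 2) (hh : MemLp h 2) :
    bl h (f - g) = bl h f - bl h g := by
  simp only [bl_comm h, bl_sub_left hf hg hh]

theorem bl_cj_cj (f g : E3 → C3) : bl (fun x => cj (f x)) (fun x => cj (g x)) = star (bl f g) := by
  simp only [bl, dot_cj_cj]
  exact integral_conj

theorem memLp_cj {f : E3 → C3} (hf : MemLp f 2) : MemLp (fun x => cj (f x)) 2 :=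
  cjL.comp_memLp' hf

theorem nrm_sub_comm (f g : E3 → C3) : nrm (f - g) = nrm (g - f) := by
  rw [nrm, eLpNorm_sub_comm, nrm]

theorem nrm_add_le {f g : E3 → C3} (hf : MemLp f 2) (hg : MemLp g 2) :
    nrm (f + g) ≤ nrm f + nrm g := by
  rw [nrm, nrm, nrm, ← ENNReal.toReal_add hf.2.ne hg.2.ne]
  exact ENNReal.toReal_mono (ENNReal.add_lt_top.2 ⟨hf.2, hg.2⟩).ne
    (eLpNorm_add_le hf.1 hg.1 (by norm_num))

theorem nrm_sub_le {f g : E3 → C3} (hf : MemLp f 2) (hg : MemLp g 2) :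
    nrm (f - g) ≤ nrm f + nrm g := by
  rw [nrm, nrm, nrm, ← ENNReal.toReal_add hf.2.ne hg.2.ne]
  exact ENNReal.toReal_mono (ENNReal.add_lt_top.2 ⟨hf.2, hg.2⟩).ne
    (eLpNorm_sub_le hf.1 hg.1 (by norm_num))

theorem nrm_sq_eq {f : E3 → C3} (hf : MemLp f 2) : nrm f ^ 2 = ∫ x, ‖f x‖ ^ 2 := by
  have h := hf.eLpNorm_eq_integral_rpow_norm (by norm_num) (by norm_num)
  have h0 : 0 ≤ ∫ x, ‖f x‖ ^ 2 := integral_nonneg fun x => by positivity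
  rw [nrm, h, ENNReal.toReal_ofReal (by positivity)]
  simp only [ENNReal.toReal_ofNat, Real.rpow_two]
  rw [← Real.rpow_natCast, ← Real.rpow_mul h0]
  norm_num

theorem bl_self_cj {f : E3 → C3} (hf : MemLp f 2) :
    bl f (fun x => cj (f x)) = ((nrm f ^ 2 : ℝ) : ℂ) := by
  simp only [bl, dot_cj_self, nrm_sq_eq hf]
  exact integral_ofReal

theorem integrable_norm_sq {f : E3 → C3} (hf : MemLp f 2) : Integrable fun x => ‖f x‖ ^ 2 := by
  simpa using hf.integrable_norm_pow (by norm_num)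

theorem nrm_le_of_norm_le {f g : E3 → C3} (hg : MemLp g 2)
    {c : ℝ} (h : ∀ᵐ x, ‖f x‖ ≤ c * ‖g x‖) (hc : 0 ≤ c) : nrm f ≤ c * nrm g := by
  have h1 := eLpNorm_le_mul_eLpNorm_of_ae_le_mul h 2
  have h2 := ENNReal.toReal_mono (ENNReal.mul_lt_top ENNReal.ofReal_lt_top hg.2).ne h1
  rwa [ENNReal.toReal_mul, ENNReal.toReal_ofReal hc] at h2

/-- The pairing is continuous for convergence in `L²`. -/
theorem tendsto_bl {f g : E3 → C3} {fn gn : ℕ → E3 → C3} (hf : MemLp f 2) (hg : MemLp g 2)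
    (hfn : ∀ n, MemLp (fn n) 2) (hgn : ∀ n, MemLp (gn n) 2)
    (h1 : Tendsto (fun n => nrm (fn n - f)) atTop (𝓝 0))
    (h2 : Tendsto (fun n => nrm (gn n - g)) atTop (𝓝 0)) :
    Tendsto (fun n => bl (fn n) (gn n)) atTop (𝓝 (bl f g)) := by
  rw [tendsto_iff_norm_sub_tendsto_zero]
  have key : ∀ n, ‖bl (fn n) (gn n) - bl f g‖ ≤
      nrm (fn n - f) * (nrm (gn n - g) + nrm g) + nrm f * nrm (gn n - g) := fun n => by
    have e : bl (fn n) (gn n) - bl f g = bl (fn n - f) (gn n) + bl f (gn n - g) := by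
      rw [bl_sub_left (hfn n) hf (hgn n), bl_sub_right (hgn n) hg hf]; ring
    rw [e]
    refine (norm_add_le _ _).trans (add_le_add ?_ (norm_bl_le hf ((hgn n).sub hg)))
    refine (norm_bl_le ((hfn n).sub hf) (hgn n)).trans ?_
    refine mul_le_mul_of_nonneg_left ?_ (nrm_nonneg _)
    have := nrm_add_le ((hgn n).sub hg) hg
    rwa [sub_add_cancel] at this
  refine squeeze_zero (fun n => norm_nonneg _) key ?_
  simpa using (h1.mul (h2.add_const (nrm g))).add (h2.const_mul (nrm f))

end MaxwellITE

namespace MaxwellITE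

open Filter Topology

/-! ### Calculus of the curl -/

/-- The standard basis vectors. -/
noncomputable abbrev stdE (j : Fin 3) : E3 := EuclideanSpace.single j 1

theorem fderiv_coord {φ : E3 → C3} {x : E3} (h : DifferentiableAt ℝ φ x) (i : Fin 3) (v : E3) :
    fderiv ℝ (fun y => φ y i) x v = (fderiv ℝ φ x v) i := by
  have := ((EuclideanSpace.proj (𝕜 := ℂ) i).restrictScalars ℝ).hasFDerivAt.comp x h.hasFDerivAt
  have h2 : HasFDerivAt (fun y => φ y i) _ x := this
  rw [h2.fderiv]; rfl

theorem partialD_eq {φ : E3 → C3} {x : E3} (h : DifferentiableAt ℝ φ x) (j i : Fin 3) :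
    partialD φ j i x = fderiv ℝ (fun y => φ y i) x (stdE j) :=
  (fderiv_coord h i _).symm

theorem contDiff_coord {n : WithTop ℕ∞} {φ : E3 → C3} (h : ContDiff ℝ n φ) (i : Fin 3) :
    ContDiff ℝ n fun y => φ y i :=
  ((EuclideanSpace.proj (𝕜 := ℂ) i).restrictScalars ℝ).contDiff.comp h

theorem contDiff_of_coord {n : WithTop ℕ∞} {φ : E3 → C3} (h : ∀ i, ContDiff ℝ n fun y => φ y i) :
    ContDiff ℝ n φ := by
  have h1 : ContDiff ℝ n fun x => (φ x).ofLp := contDiff_pi.2 h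
  exact ((PiLp.continuousLinearEquiv 2 ℂ (fun _ : Fin 3 => ℂ)).symm.toContinuousLinearMap.restrictScalars
    ℝ).contDiff.comp h1

theorem contDiff_partialD {φ : E3 → C3} (h : ContDiff ℝ ∞ φ) (j i : Fin 3) :
    ContDiff ℝ ∞ (partialD φ j i) := by
  have h1 : ContDiff ℝ ∞ fun x => fderiv ℝ φ x (stdE j) :=
    (h.fderiv_right (m := ∞) (by simp)).clm_apply contDiff_const
  exact contDiff_coord h1 i

@[simp] theorem curl_zero_apply (φ : E3 → C3) (x : E3) :
    curl φ x 0 = partialD φ 1 2 x - partialD φ 2 1 x := rfl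
@[simp] theorem curl_one_apply (φ : E3 → C3) (x : E3) :
    curl φ x 1 = partialD φ 2 0 x - partialD φ 0 2 x := rfl
@[simp] theorem curl_two_apply (φ : E3 → C3) (x : E3) :
    curl φ x 2 = partialD φ 0 1 x - partialD φ 1 0 x := rfl

theorem C3.ext3 {a b : C3} (h0 : a 0 = b 0) (h1 : a 1 = b 1) (h2 : a 2 = b 2) : a = b := by
  ext i; fin_cases i <;> assumption

theorem contDiff_curl {φ : E3 → C3} (h : ContDiff ℝ ∞ φ) : ContDiff ℝ ∞ (curl φ) := by
  refine contDiff_of_coord fun i => ?_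
  fin_cases i
  · exact (contDiff_partialD h 1 2).sub (contDiff_partialD h 2 1)
  · exact (contDiff_partialD h 2 0).sub (contDiff_partialD h 0 2)
  · exact (contDiff_partialD h 0 1).sub (contDiff_partialD h 1 0)

theorem curl_eq_zero_of_fderiv {φ : E3 → C3} {x : E3} (h : fderiv ℝ φ x = 0) : curl φ x = 0 := by
  apply C3.ext3 <;> simp [partialD, h]

theorem tsupport_curl_subset (φ : E3 → C3) : tsupport (curl φ) ⊆ tsupport φ := by
  refine (closure_mono ?_).trans (tsupport_fderiv_subset ℝ (f := φ))
  intro x hx hx'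
  exact hx (curl_eq_zero_of_fderiv hx')

theorem IsTestField.curl {φ : E3 → C3} (h : IsTestField φ) : IsTestField (curl φ) :=
  ⟨contDiff_curl h.1, h.2.of_isClosed_subset (isClosed_tsupport _) (tsupport_curl_subset φ)⟩

theorem IsTestFieldIn.curl {D : Set E3} {φ : E3 → C3} (h : IsTestFieldIn D φ) :
    IsTestFieldIn D (curl φ) :=
  ⟨h.1.curl, (tsupport_curl_subset φ).trans h.2⟩

theorem tsupport_cj (φ : E3 → C3) : tsupport (fun x => cj (φ x)) ⊆ tsupport φ :=
  closure_mono fun x hx h => hx (by simp [h])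

theorem IsTestField.cj {φ : E3 → C3} (h : IsTestField φ) : IsTestField fun x => cj (φ x) :=
  ⟨cjL.contDiff.comp h.1, h.2.of_isClosed_subset (isClosed_tsupport _) (tsupport_cj φ)⟩

theorem IsTestFieldIn.cj {D : Set E3} {φ : E3 → C3} (h : IsTestFieldIn D φ) :
    IsTestFieldIn D fun x => MaxwellITE.cj (φ x) :=
  ⟨h.1.cj, (tsupport_cj φ).trans h.2⟩

theorem IsTestField.memLp {φ : E3 → C3} (h : IsTestField φ) : MemLp φ 2 :=
  h.1.continuous.memLp_of_hasCompactSupport h.2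

theorem curl_cj {φ : E3 → C3} (h : Differentiable ℝ φ) :
    curl (fun x => cj (φ x)) = fun x => cj (curl φ x) := by
  funext x
  have h1 : fderiv ℝ (fun x => cj (φ x)) x = cjL.comp (fderiv ℝ φ x) :=
    (cjL.hasFDerivAt.comp x (h x).hasFDerivAt).fderiv
  apply C3.ext3 <;> simp [partialD, h1]

/-- Compact support is asked of one factor only, because the other will be the mollification of an
arbitrary L² field. -/
theorem integral_mul_fderiv {f g : E3 → ℂ} (hf : ContDiff ℝ 1 f) (hg : ContDiff ℝ 1 g)
    (hs : HasCompactSupport g) (v : E3) :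
    ∫ x, f x * fderiv ℝ g x v = - ∫ x, fderiv ℝ f x v * g x := by
  have cf : Continuous fun x => fderiv ℝ f x v := (hf.continuous_fderiv one_ne_zero).clm_apply
    continuous_const
  have cg : Continuous fun x => fderiv ℝ g x v := (hg.continuous_fderiv one_ne_zero).clm_apply
    continuous_const
  apply integral_mul_fderiv_eq_neg_fderiv_mul_of_integrable
  · exact (cf.mul hg.continuous).integrable_of_hasCompactSupport hs.mul_left
  · exact (hf.continuous.mul cg).integrable_of_hasCompactSupport (hs.fderiv_apply ℝ v).mul_left
  · exact (hf.continuous.mul hg.continuous).integrable_of_hasCompactSupport hs.mul_left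
  · exact fun x _ => (hf.differentiable one_ne_zero) x
  · exact fun x _ => (hg.differentiable one_ne_zero) x

theorem integral_mul_partialD {f g : E3 → C3} (hf : ContDiff ℝ ∞ f) (hg : IsTestField g)
    (i j k : Fin 3) :
    ∫ x, f x i * partialD g j k x = - ∫ x, partialD f j i x * g x k := by
  have hs : HasCompactSupport fun x => g x k :=
    hg.2.comp_left (g := fun a : C3 => a k) rfl
  have h := integral_mul_fderiv ((contDiff_coord hf i).of_le (by simp))
    ((contDiff_coord hg.1 k).of_le (by simp)) hs (stdE j)
  simp only [partialD_eq ((hf.differentiable (by simp)) _),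
    partialD_eq ((hg.1.differentiable (by simp)) _)]
  exact h

/-- Integration by parts for the curl. -/
theorem integral_dot_curl {f g : E3 → C3} (hf : ContDiff ℝ ∞ f) (hg : IsTestField g) :
    bl f (curl g) = bl (curl f) g := by
  have I1 : ∀ i j k : Fin 3, Integrable fun x => f x i * partialD g j k x := fun i j k => by
    refine Continuous.integrable_of_hasCompactSupport
      ((contDiff_coord hf i).continuous.mul (contDiff_partialD hg.1 j k).continuous) ?_
    have h1 := (hg.2.fderiv ℝ).comp_left (g := fun L : E3 →L[ℝ] C3 => (L (stdE j)) k) (by simp)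
    exact h1.mul_left
  have I2 : ∀ i j k : Fin 3, Integrable fun x => partialD f j i x * g x k := fun i j k => by
    refine Continuous.integrable_of_hasCompactSupport
      ((contDiff_partialD hf j i).continuous.mul (contDiff_coord hg.1 k).continuous) ?_
    have h1 := hg.2.comp_left (g := fun a : C3 => a k) rfl
    exact h1.mul_left
  have e1 : bl f (curl g) =
      ((∫ x, f x 0 * partialD g 1 2 x) - ∫ x, f x 0 * partialD g 2 1 x) +
      ((∫ x, f x 1 * partialD g 2 0 x) - ∫ x, f x 1 * partialD g 0 2 x) +
      ((∫ x, f x 2 * partialD g 0 1 x) - ∫ x, f x 2 * partialD g 1 0 x) := by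
    rw [← integral_sub (I1 ..) (I1 ..), ← integral_sub (I1 ..) (I1 ..),
      ← integral_sub (I1 ..) (I1 ..), ← integral_add, ← integral_add]
    · simp only [bl, dot_eq, curl_zero_apply, curl_one_apply, curl_two_apply, mul_sub]
    · exact ((I1 ..).sub (I1 ..)).add ((I1 ..).sub (I1 ..))
    · exact (I1 ..).sub (I1 ..)
    · exact (I1 ..).sub (I1 ..)
    · exact (I1 ..).sub (I1 ..)
  have e2 : bl (curl f) g =
      ((∫ x, partialD f 1 2 x * g x 0) - ∫ x, partialD f 2 1 x * g x 0) +
      ((∫ x, partialD f 2 0 x * g x 1) - ∫ x, partialD f 0 2 x * g x 1) +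
      ((∫ x, partialD f 0 1 x * g x 2) - ∫ x, partialD f 1 0 x * g x 2) := by
    rw [← integral_sub (I2 ..) (I2 ..), ← integral_sub (I2 ..) (I2 ..),
      ← integral_sub (I2 ..) (I2 ..), ← integral_add, ← integral_add]
    · simp only [bl, dot_eq, curl_zero_apply, curl_one_apply, curl_two_apply, sub_mul]
    · exact ((I2 ..).sub (I2 ..)).add ((I2 ..).sub (I2 ..))
    · exact (I2 ..).sub (I2 ..)
    · exact (I2 ..).sub (I2 ..)
    · exact (I2 ..).sub (I2 ..)
  rw [e1, e2]
  simp only [integral_mul_partialD hf hg]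
  ring

/-- The cross product of a real and a complex vector. -/
noncomputable def crossR (p : Fin 3 → ℝ) (a : C3) : C3 :=
  !₂[p 1 * a 2 - p 2 * a 1, p 2 * a 0 - p 0 * a 2, p 0 * a 1 - p 1 * a 0]

theorem norm_le_sum (a : C3) : ‖a‖ ≤ ‖a 0‖ + ‖a 1‖ + ‖a 2‖ := by
  refine abs_le_of_sq_le_sq' ?_ (by positivity) |>.2
  rw [norm_sq_eq_sum, Fin.sum_univ_three]
  nlinarith [norm_nonneg (a 0), norm_nonneg (a 1), norm_nonneg (a 2),
    mul_nonneg (norm_nonneg (a 0)) (norm_nonneg (a 1)),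
    mul_nonneg (norm_nonneg (a 0)) (norm_nonneg (a 2)),
    mul_nonneg (norm_nonneg (a 1)) (norm_nonneg (a 2))]

theorem norm_coord_le (a : C3) (i : Fin 3) : ‖a i‖ ≤ ‖a‖ := PiLp.norm_apply_le a i

theorem norm_crossR_le {p : Fin 3 → ℝ} {M : ℝ} (hp : ∀ i, |p i| ≤ M) (a : C3) :
    ‖crossR p a‖ ≤ 6 * M * ‖a‖ := by
  have h : ∀ i j k l : Fin 3, ‖(p i : ℂ) * a j - p k * a l‖ ≤ 2 * M * ‖a‖ := fun i j k l => by
    have hh : ∀ i j, ‖(p i : ℂ) * a j‖ ≤ M * ‖a‖ := fun i j => by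
      rw [norm_mul, Complex.norm_real, Real.norm_eq_abs]
      exact mul_le_mul (hp i) (norm_coord_le a j) (norm_nonneg _)
        ((abs_nonneg _).trans (hp i))
    refine (norm_sub_le _ _).trans ((add_le_add (hh _ _) (hh _ _)).trans_eq (by ring))
  refine (norm_le_sum _).trans ?_
  have h0 := h 1 2 2 1
  have h1 := h 2 0 0 2
  have h2 := h 0 1 1 0
  calc _ ≤ 2 * M * ‖a‖ + 2 * M * ‖a‖ + 2 * M * ‖a‖ := add_le_add (add_le_add h0 h1) h2
    _ = _ := by ring

/-- The gradient of a real function, in coordinates. -/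
noncomputable def grad3 (h : E3 → ℝ) (x : E3) (j : Fin 3) : ℝ := fderiv ℝ h x (stdE j)

theorem curl_smul {h : E3 → ℝ} {v : E3 → C3} {x : E3} (hh : DifferentiableAt ℝ h x)
    (hv : DifferentiableAt ℝ v x) :
    curl (fun y => h y • v y) x = h x • curl v x + crossR (grad3 h x) (v x) := by
  have h1 : ∀ j i, partialD (fun y => h y • v y) j i x =
      h x * partialD v j i x + grad3 h x j * v x i := fun j i => by
    simp only [partialD, grad3]
    rw [fderiv_fun_smul hh hv]
    simp
  apply C3.ext3 <;> simp [h1, crossR] <;> ring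

theorem IsTestField.smul {h : E3 → ℝ} {v : E3 → C3} (hh : ContDiff ℝ ∞ h)
    (hv : ContDiff ℝ ∞ v) (hs : HasCompactSupport h) : IsTestField fun y => h y • v y :=
  ⟨hh.smul hv, hs.smul_right⟩

end MaxwellITE

namespace MaxwellITE

open Filter Topology

/-! ### Mollification -/

/-- The bump function of radius `1 / (n + 1)` about the origin. -/
noncomputable def bump (n : ℕ) : ContDiffBump (0 : E3) where
  rIn := 1 / (n + 2)
  rOut := 1 / (n + 1)
  rIn_pos := by positivity
  rIn_lt_rOut := one_div_lt_one_div_of_lt (by positivity) (by linarith)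

/-- The mollifier kernel. -/
noncomputable def ker (n : ℕ) : E3 → ℝ := (bump n).normed volume

theorem ker_nonneg (n : ℕ) (x : E3) : 0 ≤ ker n x := (bump n).nonneg_normed x

theorem ker_neg (n : ℕ) (x : E3) : ker n (-x) = ker n x := (bump n).normed_neg x

theorem integrable_ker (n : ℕ) : Integrable (ker n) := (bump n).integrable_normed

theorem continuous_ker (n : ℕ) : Continuous (ker n) := (bump n).continuous_normed

theorem integral_ker (n : ℕ) : ∫ x, ker n x = 1 := (bump n).integral_normed

theorem hasCompactSupport_ker (n : ℕ) : HasCompactSupport (ker n) := (bump n).hasCompactSupport_normed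

/-- Mollification of a field. -/
noncomputable def moll (n : ℕ) (f : E3 → C3) : E3 → C3 :=
  convolution (ker n) f (ContinuousLinearMap.lsmul ℝ ℝ) volume

theorem moll_apply (n : ℕ) (f : E3 → C3) (x : E3) : moll n f x = ∫ t, ker n t • f (x - t) := rfl

theorem moll_apply_swap (n : ℕ) (f : E3 → C3) (x : E3) :
    moll n f x = ∫ t, ker n (x - t) • f t := convolution_lsmul_swap

theorem moll_congr {n : ℕ} {f g : E3 → C3} (h : f =ᵐ[volume] g) : moll n f = moll n g :=
  convolution_congr _ (EventuallyEq.refl _ _) h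

theorem contDiff_moll {f : E3 → C3} (hf : LocallyIntegrable f) (n : ℕ) : ContDiff ℝ ∞ (moll n f) :=
  (hasCompactSupport_ker n).contDiff_convolution_left _ (bump n).contDiff_normed hf

theorem locallyIntegrable_of_memLp {f : E3 → C3} (hf : MemLp f 2) : LocallyIntegrable f :=
  hf.locallyIntegrable (by norm_num)

theorem moll_sub {f g : E3 → C3} (hf : LocallyIntegrable f) (hg : LocallyIntegrable g) (n : ℕ) :
    moll n (f - g) = moll n f - moll n g := by
  funext x
  have h1 := (hasCompactSupport_ker n).convolutionExists_left (ContinuousLinearMap.lsmul ℝ ℝ)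
    (continuous_ker n) hf x
  have h2 := (hasCompactSupport_ker n).convolutionExists_left (ContinuousLinearMap.lsmul ℝ ℝ)
    (continuous_ker n) hg x
  simp only [moll_apply, Pi.sub_apply, smul_sub]
  exact integral_sub h1 h2

/-- The kernel lives in the ball of radius 1 / (n + 1), so this controls supports of mollified
fields. -/
theorem moll_eq_zero {n : ℕ} {f : E3 → C3} {x : E3}
    (h : ∀ y ∈ Metric.ball x (1 / ((n : ℝ) + 1)), f y = 0) : moll n f x = 0 := by
  have hx : f x = 0 := h x (Metric.mem_ball_self (by positivity))
  have := (bump n).normed_convolution_eq_right (μ := volume) (g := f) (x₀ := x)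
    (fun y hy => by rw [h y hy, hx])
  rw [← hx]; exact this

theorem hasCompactSupport_moll {f : E3 → C3} (hf : HasCompactSupport f) (n : ℕ) :
    HasCompactSupport (moll n f) :=
  (hasCompactSupport_ker n).convolution _ hf

theorem isTestField_moll {f : E3 → C3} (hf : MemLp f 2) (hs : HasCompactSupport f) (n : ℕ) :
    IsTestField (moll n f) :=
  ⟨contDiff_moll (locallyIntegrable_of_memLp hf) n, hasCompactSupport_moll hs n⟩

theorem eLpNorm_moll_le {f : E3 → C3} (hf : MemLp f 2) (n : ℕ) :
    eLpNorm (moll n f) 2 ≤ eLpNorm f 2 := by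
  wlog hm : StronglyMeasurable f generalizing f
  · have h := hf.1.ae_eq_mk
    have := this (hf.ae_eq h) hf.1.stronglyMeasurable_mk
    rwa [← moll_congr h, ← eLpNorm_congr_ae h] at this
  -- The kernel turns Lebesgue measure into a probability measure. Monotonicity of L^p means then
  -- bounds |moll n f x|² by the ν-average of |f(x - y)|², and Tonelli with translation invariance
  -- concludes.
  set ν : Measure E3 := volume.withDensity fun x => ‖ker n x‖ₑ with hν
  have hkm : Measurable fun x => ‖ker n x‖ₑ := (continuous_ker n).measurable.enorm
  have hν1 : ν Set.univ = 1 := by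
    rw [hν, withDensity_apply _ MeasurableSet.univ, Measure.restrict_univ,
      ← ofReal_integral_norm_eq_lintegral_enorm (integrable_ker n)]
    simp [abs_of_nonneg (ker_nonneg n _), integral_ker]
  have : IsProbabilityMeasure ν := ⟨hν1⟩
  have key : ∀ x, ‖moll n f x‖ₑ ^ (2 : ℝ) ≤ ∫⁻ y, ‖f (x - y)‖ₑ ^ (2 : ℝ) ∂ν := fun x => by
    have hmx : StronglyMeasurable fun y => f (x - y) :=
      hm.comp_measurable (measurable_const.sub measurable_id)
    have h1 : ‖moll n f x‖ₑ ≤ ∫⁻ y, ‖f (x - y)‖ₑ ∂ν := by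
      rw [moll_apply, hν, lintegral_withDensity_eq_lintegral_mul _ hkm hmx.enorm]
      refine (enorm_integral_le_lintegral_enorm _).trans_eq ?_
      simp [enorm_smul]
    have h2 := eLpNorm'_le_eLpNorm'_of_exponent_le (p := 1) (q := 2) (by norm_num) (by norm_num) ν
      hmx.aestronglyMeasurable
    have h3 := ENNReal.rpow_le_rpow (z := 2) (h1.trans
      (by simpa [eLpNorm'] using h2)) (by norm_num)
    refine h3.trans_eq ?_
    rw [← ENNReal.rpow_mul]; norm_num
  rw [eLpNorm_eq_lintegral_rpow_enorm_toReal (by norm_num) (by norm_num),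
    eLpNorm_eq_lintegral_rpow_enorm_toReal (by norm_num) (by norm_num)]
  refine ENNReal.rpow_le_rpow ?_ (by norm_num)
  simp only [ENNReal.toReal_ofNat]
  calc ∫⁻ x, ‖moll n f x‖ₑ ^ (2 : ℝ) ≤ ∫⁻ x, ∫⁻ y, ‖f (x - y)‖ₑ ^ (2 : ℝ) ∂ν := lintegral_mono key
    _ = ∫⁻ y, (∫⁻ x, ‖f (x - y)‖ₑ ^ (2 : ℝ)) ∂ν := by
        refine lintegral_lintegral_swap ?_
        have : Measurable fun p : E3 × E3 => ‖f (p.1 - p.2)‖ₑ ^ (2 : ℝ) :=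
          ((hm.comp_measurable (measurable_fst.sub measurable_snd)).enorm).pow_const _
        exact this.aemeasurable
    _ = ∫⁻ y, (∫⁻ x, ‖f x‖ₑ ^ (2 : ℝ)) ∂ν := by
        refine lintegral_congr fun y => ?_
        exact lintegral_sub_right_eq_self (fun x => ‖f x‖ₑ ^ (2 : ℝ)) y
    _ = ∫⁻ x, ‖f x‖ₑ ^ (2 : ℝ) := by simp

theorem memLp_moll {f : E3 → C3} (hf : MemLp f 2) (n : ℕ) : MemLp (moll n f) 2 :=
  ⟨(contDiff_moll (locallyIntegrable_of_memLp hf) n).continuous.aestronglyMeasurable,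
    (eLpNorm_moll_le hf n).trans_lt hf.2⟩

theorem nrm_moll_le {f : E3 → C3} (hf : MemLp f 2) (n : ℕ) : nrm (moll n f) ≤ nrm f :=
  ENNReal.toReal_mono hf.2.ne (eLpNorm_moll_le hf n)

/-- Uniform continuity makes the error uniformly small, and the error lives in the unit thickening
of the support, which has finite measure. The field `b` is the indicator of that set, made vector
valued so that `nrm` applies. -/
theorem tendsto_moll_of_isTestField {g : E3 → C3} (hg : IsTestField g) :
    Tendsto (fun n => nrm (moll n g - g)) atTop (𝓝 0) := by
  have hK : IsCompact (Metric.cthickening 1 (tsupport g)) := hg.2.isCompact.cthickening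
  set K := Metric.cthickening 1 (tsupport g) with hKdef
  have hi : MemLp (K.indicator fun _ => (EuclideanSpace.single 0 1 : C3)) 2 :=
    memLp_indicator_const 2 hK.measurableSet _ (Or.inr hK.measure_lt_top.ne)
  set b : E3 → C3 := K.indicator fun _ => (EuclideanSpace.single 0 1 : C3) with hb
  have huc : UniformContinuous g := hg.2.uniformContinuous_of_continuous hg.1.continuous
  rw [Metric.tendsto_atTop]
  intro ε hε
  have hnb : 0 < nrm b + 1 := by have := nrm_nonneg b; linarith
  obtain ⟨δ, hδ, hδ'⟩ := Metric.uniformContinuous_iff.1 huc (ε / (nrm b + 1)) (by positivity)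
  obtain ⟨N, hN⟩ := exists_nat_one_div_lt hδ
  refine ⟨N, fun n hn => ?_⟩
  have hr : (1 : ℝ) / (n + 1) < δ := lt_of_le_of_lt
    (one_div_le_one_div_of_le (by positivity) (by exact_mod_cast Nat.succ_le_succ hn)) hN
  have hr1 : (1 : ℝ) / (n + 1) ≤ 1 := by
    rw [div_le_one (by positivity)]; linarith [Nat.cast_nonneg (α := ℝ) n]
  have hpt : ∀ x, ‖(moll n g - g) x‖ ≤ ε / (nrm b + 1) * ‖b x‖ := fun x => by
    by_cases hx : x ∈ K
    · have h1 := (bump n).dist_normed_convolution_le (μ := volume) (g := g) (x₀ := x)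
        (ε := ε / (nrm b + 1)) hg.1.continuous.aestronglyMeasurable
        (fun y hy => (hδ' (lt_trans hy hr)).le)
      rw [dist_eq_norm] at h1
      have h2 : ‖b x‖ = 1 := by simp [hb, hx]
      rw [h2, mul_one]
      exact h1
    · have h0 : ∀ y ∈ Metric.ball x (1 / ((n : ℝ) + 1)), g y = 0 := fun y hy => by
        by_contra hne
        refine hx (Metric.mem_cthickening_of_dist_le x y 1 _ (subset_tsupport g hne) ?_)
        rw [dist_comm]
        exact (le_of_lt hy).trans hr1
      simp [moll_eq_zero h0, h0 x (Metric.mem_ball_self (by positivity)), hb, hx]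
  have h2 := nrm_le_of_norm_le hi (Eventually.of_forall hpt) (by positivity)
  rw [dist_zero_right, Real.norm_eq_abs, abs_of_nonneg (nrm_nonneg _)]
  refine h2.trans_lt ?_
  rw [div_mul_eq_mul_div, div_lt_iff₀ hnb]
  nlinarith

theorem exists_isTestField_nrm_sub_le {f : E3 → C3} (hf : MemLp f 2) {ε : ℝ} (hε : 0 < ε) :
    ∃ g, IsTestField g ∧ nrm (f - g) ≤ ε := by
  obtain ⟨g, h1, h2, h3⟩ := hf.exist_eLpNorm_sub_le (by norm_num) (by norm_num) hε
  exact ⟨g, ⟨h2, h1⟩, ENNReal.toReal_le_of_le_ofReal hε.le h3⟩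

/-- Mollifications converge in `L²`. -/
theorem tendsto_moll {f : E3 → C3} (hf : MemLp f 2) :
    Tendsto (fun n => nrm (moll n f - f)) atTop (𝓝 0) := by
  rw [Metric.tendsto_atTop]
  intro ε hε
  obtain ⟨g, hg, hfg⟩ := exists_isTestField_nrm_sub_le hf (ε := ε / 4) (by positivity)
  obtain ⟨N, hN⟩ := Metric.tendsto_atTop.1 (tendsto_moll_of_isTestField hg) (ε / 4) (by positivity)
  refine ⟨N, fun n hn => ?_⟩
  have h1 := hN n hn
  rw [dist_zero_right, Real.norm_eq_abs, abs_of_nonneg (nrm_nonneg _)] at h1 ⊢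
  have hfgL := hf.sub hg.memLp
  -- Mollification is an L² contraction, so passing from f to the smooth g costs ‖f - g‖ twice.
  have e : moll n f - f = (moll n (f - g) + (moll n g - g)) + (g - f) := by
    rw [moll_sub (locallyIntegrable_of_memLp hf) (locallyIntegrable_of_memLp hg.memLp)]; abel
  have a1 := nrm_moll_le hfgL n
  have a2 := nrm_add_le (memLp_moll hfgL n) ((memLp_moll hg.memLp n).sub hg.memLp)
  have a3 := nrm_add_le ((memLp_moll hfgL n).add ((memLp_moll hg.memLp n).sub hg.memLp))
    (hg.memLp.sub hf)
  rw [nrm_sub_comm g f] at a3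
  rw [e]
  linarith

/-- Mollification is symmetric for the bilinear pairing. -/
theorem bl_moll {f g : E3 → C3} (hf : MemLp f 2) (hg : MemLp g 2) (n : ℕ) :
    bl (moll n f) g = bl f (moll n g) := by
  -- Fubini needs joint integrability: |f(y)·g(x)| ≤ |f(y)|² + |g(x)|², and each square is an L¹
  -- function convolved with the kernel.
  have hI : Integrable (fun p : E3 × E3 => ker n (p.1 - p.2) • dot (f p.2) (g p.1))
      (volume.prod volume) := by
    have i1 : Integrable (fun p : E3 × E3 => ‖f p.2‖ ^ 2 * ker n (p.1 - p.2))
        (volume.prod volume) :=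
      (integrable_norm_sq hf).convolution_integrand (ContinuousLinearMap.mul ℝ ℝ)
        (integrable_ker n)
    have i2 : Integrable (fun p : E3 × E3 => ‖g p.2‖ ^ 2 * ker n (p.1 - p.2))
        (volume.prod volume) :=
      (integrable_norm_sq hg).convolution_integrand (ContinuousLinearMap.mul ℝ ℝ)
        (integrable_ker n)
    refine (i1.add i2.swap).mono' ?_ (Eventually.of_forall fun p => ?_)
    · have m1 : AEStronglyMeasurable (fun p : E3 × E3 => ker n (p.1 - p.2))
          (volume.prod volume) :=
        ((continuous_ker n).comp (continuous_fst.sub continuous_snd)).aestronglyMeasurable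
      exact m1.smul (dotL.aestronglyMeasurable_comp₂ hf.1.comp_snd hg.1.comp_fst)
    · have h1 := norm_dot_le (f p.2) (g p.1)
      have h2 := ker_nonneg n (p.1 - p.2)
      have h3 : ker n (p.2 - p.1) = ker n (p.1 - p.2) := by rw [← neg_sub, ker_neg]
      simp only [norm_smul, Real.norm_eq_abs, abs_of_nonneg h2, Pi.add_apply, Function.comp_apply,
        Prod.fst_swap, Prod.snd_swap, h3]
      rw [← add_mul, mul_comm]
      refine mul_le_mul_of_nonneg_right (h1.trans ?_) h2
      nlinarith [sq_nonneg (‖f p.2‖ - ‖g p.1‖), sq_nonneg (‖f p.2‖), sq_nonneg (‖g p.1‖)]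
  have hex : ∀ {h : E3 → C3}, MemLp h 2 → ∀ x, Integrable fun t => ker n (x - t) • h t :=
    fun hh x => by
      have := (hasCompactSupport_ker n).convolutionExists_left (ContinuousLinearMap.lsmul ℝ ℝ)
        (continuous_ker n) (locallyIntegrable_of_memLp hh) x
      exact this.integrable_swap
  have e1 : bl (moll n f) g = ∫ x, ∫ y, ker n (x - y) • dot (f y) (g x) := by
    refine integral_congr_ae (Eventually.of_forall fun x => ?_)
    have := (dotL.flip (g x)).integral_comp_comm (hex hf x)
    simp only [ContinuousLinearMap.flip_apply, dotL_apply, dot_real_smul_left] at this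
    simp only [moll_apply_swap, this]
  have e2 : bl f (moll n g) = ∫ y, ∫ x, ker n (x - y) • dot (f y) (g x) := by
    refine integral_congr_ae (Eventually.of_forall fun y => ?_)
    have := (dotL (f y)).integral_comp_comm (hex hg y)
    simp only [dotL_apply, dot_real_smul_right] at this
    simp only [moll_apply_swap, ← this]
    refine integral_congr_ae (Eventually.of_forall fun x => ?_)
    simp only [← ker_neg n (y - x), neg_sub]
  rw [e1, e2]
  exact integral_integral_swap hI

/-- The curl as a linear function of the derivative. -/
noncomputable def curlL : (E3 →L[ℝ] C3) →L[ℝ] C3 :=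
  LinearMap.toContinuousLinearMap
    { toFun := fun L => !₂[L (stdE 1) 2 - L (stdE 2) 1, L (stdE 2) 0 - L (stdE 0) 2,
        L (stdE 0) 1 - L (stdE 1) 0]
      map_add' := fun L M => by apply C3.ext3 <;> simp <;> ring
      map_smul' := fun c L => by apply C3.ext3 <;> simp <;> ring }

theorem curl_eq_curlL (φ : E3 → C3) (x : E3) : curl φ x = curlL (fderiv ℝ φ x) := rfl

/-- Mollification commutes with the curl. -/
theorem curl_moll {g : E3 → C3} (hg : IsTestField g) (n : ℕ) :
    curl (moll n g) = moll n (curl g) := by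
  funext x
  have hk := (integrable_ker n).locallyIntegrable
  have h1 := hg.2.hasFDerivAt_convolution_right (ContinuousLinearMap.lsmul ℝ ℝ) hk
    (hg.1.of_le (by simp)) x
  have hfd : ContDiff ℝ ∞ (fderiv ℝ g) := hg.1.fderiv_right (by simp)
  have h2 := (hg.2.fderiv ℝ).convolutionExists_right
    ((ContinuousLinearMap.lsmul ℝ ℝ).precompR E3 : ℝ →L[ℝ] (E3 →L[ℝ] C3) →L[ℝ] (E3 →L[ℝ] C3)) hk
    hfd.continuous x
  rw [curl_eq_curlL, moll, h1.fderiv]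
  refine (curlL.integral_comp_comm h2).symm.trans ?_
  refine integral_congr_ae (Eventually.of_forall fun t => ?_)
  change curlL (ker n t • fderiv ℝ g (x - t)) = _
  rw [map_smul]; rfl

/-- Mollification turns a weak curl on the whole space into a classical one. -/
theorem curl_moll_of_weak {u w : E3 → C3} (hu : MemLp u 2) (hw : MemLp w 2)
    (h : ∀ φ, IsTestField φ → bl u (curl φ) = bl w φ) (n : ℕ) :
    curl (moll n u) = moll n w := by
  have hcu := contDiff_moll (locallyIntegrable_of_memLp hu) n
  have hcw := contDiff_moll (locallyIntegrable_of_memLp hw) n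
  -- Mollification is symmetric for the pairing and commutes with the curl of test fields, so it can
  -- be moved onto φ, where the weak identity applies. The fundamental lemma and continuity then
  -- give equality at every point.
  have key : ∀ φ, IsTestField φ → bl (curl (moll n u)) φ = bl (moll n w) φ := fun φ hφ => by
    rw [← integral_dot_curl hcu hφ, bl_moll hu hφ.curl.memLp, ← curl_moll hφ,
      h _ (isTestField_moll hφ.memLp hφ.2 n), bl_moll hw hφ.memLp]
  have hae : curl (moll n u) =ᵐ[volume] moll n w := by
    refine ae_eq_of_integral_contDiff_smul_eq (contDiff_curl hcu).continuous.locallyIntegrable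
      hcw.continuous.locallyIntegrable fun g hg hgs => ?_
    ext i
    have ht : IsTestField fun x => g x • (EuclideanSpace.single i 1 : C3) :=
      ⟨hg.smul contDiff_const, hgs.smul_right⟩
    have hk := key _ ht
    have hp : ∀ {v : E3 → C3}, Continuous v →
        (∫ x, g x • v x) i = bl v fun x => g x • (EuclideanSpace.single i 1 : C3) := fun {v} hv => by
      have hi : Integrable fun x => g x • v x :=
        (hg.continuous.smul hv).integrable_of_hasCompactSupport hgs.smul_right
      have := ((EuclideanSpace.proj (𝕜 := ℂ) i : C3 →L[ℂ] ℂ).restrictScalars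
        ℝ).integral_comp_comm hi
      refine this.symm.trans (integral_congr_ae (Eventually.of_forall fun x => ?_))
      simp [dot, mul_comm]
    rw [hp (contDiff_curl hcu).continuous, hp hcw.continuous, hk]
  exact ((contDiff_curl hcu).continuous.ae_eq_iff_eq volume hcw.continuous).1 hae

end MaxwellITE

namespace MaxwellITE

open Filter Topology

/-! ### Energy identity and interior decay -/

theorem tendsto_nrm_smul_cj {f : E3 → C3} {fn : ℕ → E3 → C3} {h : E3 → ℝ} {M : ℝ} (hM : 0 ≤ M)
    (hh : ∀ x, |h x| ≤ M) (hf : MemLp f 2) (hfn : ∀ n, MemLp (fn n) 2)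
    (hl : Tendsto (fun n => nrm (fn n - f)) atTop (𝓝 0)) :
    Tendsto (fun n => nrm ((fun x => h x • cj (fn n x)) - fun x => h x • cj (f x)))
      atTop (𝓝 0) := by
  refine squeeze_zero (fun n => nrm_nonneg _) (fun n => ?_) (by simpa using hl.const_mul M)
  refine nrm_le_of_norm_le ((hfn n).sub hf) (Eventually.of_forall fun x => ?_) hM
  simp only [Pi.sub_apply, ← smul_sub, ← cj_sub, norm_smul, norm_cj, Real.norm_eq_abs]
  exact mul_le_mul_of_nonneg_right (hh x) (norm_nonneg _)

/-- The energy `∫ curl curl u · ū` is nonnegative. -/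
theorem re_bl_curl_curl_nonneg {u w z : E3 → C3} (hu : MemLp u 2) (hw : MemLp w 2)
    (hz : MemLp z 2) (hs : HasCompactSupport u)
    (h1 : ∀ φ, IsTestField φ → bl u (curl φ) = bl w φ)
    (h2 : ∀ φ, IsTestField φ → bl w (curl φ) = bl z φ) :
    0 ≤ (bl z fun x => cj (u x)).re := by
  -- For mollified fields the weak curls are classical, so integration by parts yields the exact
  -- value ‖moll n w‖²; its sign survives the limit.
  have hn : ∀ n, bl (moll n z) (fun x => (1 : ℝ) • cj (moll n u x)) =
      ((nrm (moll n w) ^ 2 : ℝ) : ℂ) := fun n => by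
    have ht := isTestField_moll hu hs n
    simp only [one_smul]
    rw [← curl_moll_of_weak hw hz h2 n,
      ← integral_dot_curl (contDiff_moll (locallyIntegrable_of_memLp hw) n) ht.cj,
      curl_cj (ht.1.differentiable (by simp)), curl_moll_of_weak hu hw h1 n,
      bl_self_cj (memLp_moll hw n)]
  have hcl := tendsto_nrm_smul_cj (h := fun _ => 1) (M := 1) zero_le_one (by simp) hu
    (fun n => memLp_moll hu n) (tendsto_moll hu)
  simp only [one_smul] at hcl
  have hl := tendsto_bl hz (memLp_cj hu) (fun n => memLp_moll hz n)
    (fun n => memLp_cj (memLp_moll hu n)) (tendsto_moll hz)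
    hcl
  refine ge_of_tendsto (Complex.continuous_re.continuousAt.tendsto.comp hl)
    (Eventually.of_forall fun n => ?_)
  have := hn n
  simp only [one_smul] at this
  simp only [Function.comp_apply, this, Complex.ofReal_re]
  positivity

/-- Mollifications of fields supported in a compact subset of `D` are test fields on `D`. -/
theorem eventually_isTestFieldIn_moll {D K : Set E3} (hD : IsOpen D) (hK : IsCompact K)
    (hKD : K ⊆ D) :
    ∀ᶠ n in atTop, ∀ f : E3 → C3, MemLp f 2 → tsupport f ⊆ K → IsTestFieldIn D (moll n f) := by
  obtain ⟨δ, hδ, hδ'⟩ := hK.exists_cthickening_subset_open hD hKD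
  obtain ⟨N, hN⟩ := exists_nat_one_div_lt hδ
  filter_upwards [eventually_ge_atTop N] with n hn f hf hfs
  have hr : (1 : ℝ) / (n + 1) ≤ δ := (lt_of_le_of_lt
    (one_div_le_one_div_of_le (by positivity) (by exact_mod_cast Nat.succ_le_succ hn)) hN).le
  have hs : HasCompactSupport f := hK.of_isClosed_subset (isClosed_tsupport f) hfs
  refine ⟨isTestField_moll hf hs n, Set.Subset.trans ?_ hδ'⟩
  refine closure_minimal (fun x hx => ?_) Metric.isClosed_cthickening
  by_contra hxK
  refine hx (moll_eq_zero fun y hy => ?_)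
  by_contra hne
  refine hxK (Metric.mem_cthickening_of_dist_le x y δ _ (hfs (subset_tsupport f hne)) ?_)
  rw [dist_comm]
  exact (le_of_lt hy).trans hr

theorem crossR_smul (c : ℝ) (p : Fin 3 → ℝ) (a : C3) :
    crossR (fun i => c * p i) a = c • crossR p a := by
  apply C3.ext3 <;> simp [crossR] <;> ring

/-- Completing the square. With t = χ, c = curl F and X = ∇χ × F̄, this is how the cross term of the
Caccioppoli estimate is absorbed by χ²|curl F|². -/
theorem neg_norm_sq_le_re_dot (t : ℝ) (c X : C3) :
    -‖X‖ ^ 2 ≤ (dot c (t ^ 2 • cj c + (2 * t) • X)).re := by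
  have h1 := (Complex.abs_re_le_norm _).trans (norm_dot_le c X)
  have h2 : (dot c (t ^ 2 • cj c + (2 * t) • X)).re = t ^ 2 * ‖c‖ ^ 2 + 2 * t * (dot c X).re := by
    rw [dot_add_right, dot_real_smul_right, dot_real_smul_right, dot_cj_self]
    simp only [Complex.add_re, Complex.real_smul, Complex.re_ofReal_mul, Complex.ofReal_re]
  rw [h2]
  have h3 : |t * (dot c X).re| ≤ |t| * (‖c‖ * ‖X‖) := by
    rw [abs_mul]; exact mul_le_mul_of_nonneg_left h1 (abs_nonneg _)
  have h4 := neg_abs_le (t * (dot c X).re)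
  nlinarith [sq_nonneg (|t| * ‖c‖ - ‖X‖), sq_abs t]

theorem exists_abs_grad3_le {χ : E3 → ℝ} (h : ContDiff ℝ ∞ χ) (hs : HasCompactSupport χ) :
    ∃ M, 0 ≤ M ∧ ∀ x i, |grad3 χ x i| ≤ M := by
  have hc : Continuous (fderiv ℝ χ) := h.continuous_fderiv (by simp)
  obtain ⟨M, hM⟩ := (hs.fderiv ℝ).exists_bound_of_continuous hc
  refine ⟨M, (norm_nonneg _).trans (hM 0), fun x i => ?_⟩
  have := (fderiv ℝ χ x).le_opNorm (stdE i)
  simp only [PiLp.norm_single, norm_one, mul_one] at this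
  exact this.trans (hM x)

/-- The interior (Caccioppoli type) estimate for weak solutions of `curl curl F + G = 0`. -/
theorem exists_interior_bound {D : Set E3} (hD : IsOpen D) {χ : E3 → ℝ} (hχ : ContDiff ℝ ∞ χ)
    (hχs : HasCompactSupport χ) (hχD : tsupport χ ⊆ D) :
    ∃ C : ℝ, 0 ≤ C ∧ ∀ F G : E3 → C3, MemLp F 2 → MemLp G 2 →
      (∀ φ, IsTestFieldIn D φ → bl F (curl (curl φ)) + bl G φ = 0) →
      (bl G fun x => χ x ^ 2 • cj (F x)).re ≤ C * nrm F ^ 2 := by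
  obtain ⟨M, hM, hMg⟩ := exists_abs_grad3_le hχ hχs
  obtain ⟨B, hB⟩ := hχs.exists_bound_of_continuous hχ.continuous
  refine ⟨(6 * M) ^ 2, by positivity, fun F G hF hG h => ?_⟩
  have hχ2 : ContDiff ℝ ∞ fun x => χ x ^ 2 := hχ.pow 2
  have hχ2s : tsupport (fun x => χ x ^ 2) ⊆ tsupport χ :=
    closure_mono fun x hx h => hx (by simp [h])
  have hχ2c : HasCompactSupport fun x => χ x ^ 2 :=
    hχs.of_isClosed_subset (isClosed_tsupport _) hχ2s
  have hb2 : ∀ x, |χ x ^ 2| ≤ B ^ 2 := fun x => by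
    rw [abs_pow]; exact pow_le_pow_left₀ (abs_nonneg _) (hB x) 2
  have hsm : ∀ {f : E3 → C3}, MemLp f 2 → MemLp (fun x => χ x ^ 2 • cj (f x)) 2 := fun {f} hf => by
    refine (memLp_cj hf).of_le_mul (c := B ^ 2)
      (hχ2.continuous.aestronglyMeasurable.smul (memLp_cj hf).1)
      (Eventually.of_forall fun x => ?_)
    rw [norm_smul]
    exact mul_le_mul_of_nonneg_right (hb2 x) (norm_nonneg _)
  have hl := tendsto_bl hG (hsm hF) (fun n => memLp_moll hG n)
    (fun n => hsm (memLp_moll hF n)) (tendsto_moll hG)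
    (tendsto_nrm_smul_cj (sq_nonneg B) hb2 hF (fun n => memLp_moll hF n) (tendsto_moll hF))
  refine le_of_tendsto (Complex.continuous_re.continuousAt.tendsto.comp hl) ?_
  -- The threshold on n is uniform over all fields supported in the support of χ, which matters
  -- since the field φ below depends on n.
  filter_upwards [eventually_isTestFieldIn_moll hD hχs.isCompact hχD] with n hn
  have hcF := contDiff_moll (locallyIntegrable_of_memLp hF) n
  set f := moll n F with hf
  have hcjf : ContDiff ℝ ∞ fun x => cj (f x) := cjL.contDiff.comp hcF
  set φ : E3 → C3 := fun x => χ x ^ 2 • cj (f x) with hφ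
  have ht : IsTestField φ := IsTestField.smul hχ2 hcjf hχ2c
  have hts : tsupport φ ⊆ tsupport χ := (tsupport_smul_subset_left _ _).trans hχ2s
  -- Testing with `moll n φ` instead of φ and moving the mollifier back gives the same equation for
  -- the smooth fields `moll n F` and `moll n G`.
  have e0 := h _ (hn φ ht.memLp hts)
  rw [curl_moll ht, curl_moll ht.curl, ← bl_moll hF ht.curl.curl.memLp,
    ← bl_moll hG ht.memLp, integral_dot_curl hcF ht.curl] at e0
  have hcurl : ∀ x, curl φ x =
      χ x ^ 2 • cj (curl f x) + (2 * χ x) • crossR (grad3 χ x) (cj (f x)) := fun x => by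
    rw [hφ, curl_smul (hχ2.differentiable (by simp) x) (hcjf.differentiable (by simp) x),
      curl_cj (hcF.differentiable (by simp)), ← crossR_smul]
    congr 2
    funext j
    simp only [grad3]
    rw [((hχ.differentiable (by simp) x).hasFDerivAt.pow 2).fderiv]
    simp
  have hpt : ∀ x, -((6 * M) ^ 2 * ‖f x‖ ^ 2) ≤ (dot (curl f x) (curl φ x)).re := fun x => by
    rw [hcurl]
    refine le_trans ?_ (neg_norm_sq_le_re_dot _ _ _)
    have := norm_crossR_le (hMg x) (cj (f x))
    rw [norm_cj] at this
    have := pow_le_pow_left₀ (norm_nonneg _) this 2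
    rw [mul_pow] at this
    linarith
  have hint : Integrable fun x => dot (curl f x) (curl φ x) := by
    refine Continuous.integrable_of_hasCompactSupport
      ((dotL.continuous.comp (contDiff_curl hcF).continuous).clm_apply
        ht.curl.1.continuous) ?_
    refine ht.curl.2.mono' ?_
    intro x hx
    refine subset_tsupport _ fun h0 => hx ?_
    change dot _ _ = 0
    rw [h0, dot_zero_right]
  have hre : (bl (curl f) (curl φ)).re = ∫ x, (dot (curl f x) (curl φ x)).re :=
    (Complex.reCLM.integral_comp_comm hint).symm
  have hle : -((6 * M) ^ 2 * nrm f ^ 2) ≤ (bl (curl f) (curl φ)).re := by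
    rw [hre, nrm_sq_eq (memLp_moll hF n), ← integral_const_mul, ← integral_neg]
    exact integral_mono ((integrable_norm_sq (memLp_moll hF n)).const_mul _).neg
      (Complex.reCLM.integrable_comp hint) hpt
  have hnn : nrm f ^ 2 ≤ nrm F ^ 2 := pow_le_pow_left₀ (nrm_nonneg _) (nrm_moll_le hF n) 2
  have e1 := congrArg Complex.re e0
  simp only [Complex.add_re, Complex.zero_re] at e1
  have := mul_le_mul_of_nonneg_left hnn (sq_nonneg (6 * M))
  simp only [Function.comp_apply]
  linarith

end MaxwellITE

namespace MaxwellITE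

open Filter Topology

/-! ### The gradient of a curl is controlled by its curl -/

theorem fderiv_fderiv_comm {F : Type*} [NormedAddCommGroup F] [NormedSpace ℝ F] {g : E3 → F}
    (hg : ContDiff ℝ ∞ g) (x u v : E3) :
    fderiv ℝ (fun y => fderiv ℝ g y v) x u = fderiv ℝ (fun y => fderiv ℝ g y u) x v := by
  have hd : DifferentiableAt ℝ (fderiv ℝ g) x :=
    (hg.fderiv_right (m := ∞) (by simp)).differentiable (by simp) x
  have h : ∀ u v, fderiv ℝ (fun y => fderiv ℝ g y v) x u = fderiv ℝ (fderiv ℝ g) x u v :=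
    fun u v => by
      rw [fderiv_clm_apply hd (differentiableAt_const v)]; simp
  rw [h, h]
  exact (hg.contDiffAt.isSymmSndFDerivAt
    (by simpa using WithTop.coe_le_coe.2 (le_top : (2 : ℕ∞) ≤ ⊤))) u v

/-- Integrating by parts puts both derivatives on g, where they commute. -/
theorem integral_fderiv_mul_fderiv_comm {f g : E3 → ℂ} (hf : ContDiff ℝ ∞ f) (hg : ContDiff ℝ ∞ g)
    (hs : HasCompactSupport g) (u v : E3) :
    ∫ x, fderiv ℝ f x u * fderiv ℝ g x v = ∫ x, fderiv ℝ f x v * fderiv ℝ g x u := by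
  have hd : ∀ v, ContDiff ℝ 1 fun x => fderiv ℝ g x v := fun v =>
    ((hg.fderiv_right (m := ∞) (by simp)).of_le (by simp)).clm_apply contDiff_const
  have h1 := integral_mul_fderiv (hf.of_le (by simp)) (hd v) (hs.fderiv_apply ℝ v) u
  have h2 := integral_mul_fderiv (hf.of_le (by simp)) (hd u) (hs.fderiv_apply ℝ u) v
  simp only [fderiv_fderiv_comm hg _ u v] at h1
  rw [h1, neg_inj] at h2
  exact h2

theorem div_curl {v : E3 → C3} (hv : ContDiff ℝ ∞ v) (x : E3) :
    partialD (curl v) 0 0 x + partialD (curl v) 1 1 x + partialD (curl v) 2 2 x = 0 := by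
  have hd := (contDiff_curl hv).differentiable (by simp) x
  have hp : ∀ j i, DifferentiableAt ℝ (partialD v j i) x := fun j i =>
    (contDiff_partialD hv j i).differentiable (by simp) x
  have hs : ∀ j k i, fderiv ℝ (partialD v j i) x (stdE k) = fderiv ℝ (partialD v k i) x (stdE j) :=
    fun j k i => by
      have e : ∀ j, partialD v j i = fun y => fderiv ℝ (fun y => v y i) y (stdE j) := fun j => by
        funext y; exact partialD_eq (hv.differentiable (by simp) y) j i
      rw [e, e]
      exact fderiv_fderiv_comm (contDiff_coord hv i) x _ _
  rw [partialD_eq hd, partialD_eq hd, partialD_eq hd]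
  simp only [curl_zero_apply, curl_one_apply, curl_two_apply]
  rw [fderiv_fun_sub (hp _ _) (hp _ _), fderiv_fun_sub (hp _ _) (hp _ _),
    fderiv_fun_sub (hp _ _) (hp _ _)]
  simp only [_root_.sub_apply]
  rw [hs 1 0 2, hs 2 0 1, hs 2 1 0]
  ring

theorem integral_partialD_mul_comm {w : E3 → C3} (hw : IsTestField w) (i j k l : Fin 3) :
    ∫ x, partialD w i k x * star (partialD w j l x) =
      ∫ x, partialD w j k x * star (partialD w i l x) := by
  have hd := hw.1.differentiable (by simp)
  have hd' := hw.cj.1.differentiable (by simp)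
  have e : ∀ j l x, star (partialD w j l x) = fderiv ℝ (fun y => cj (w y) l) x (stdE j) :=
    fun j l x => by
      rw [← partialD_eq (hd' x)]
      have h1 : fderiv ℝ (fun x => cj (w x)) x = cjL.comp (fderiv ℝ w x) :=
        (cjL.hasFDerivAt.comp x (hd x).hasFDerivAt).fderiv
      simp [partialD, h1]
  simp only [e]
  simp only [partialD_eq (hd _)]
  exact integral_fderiv_mul_fderiv_comm (contDiff_coord hw.1 k) (contDiff_coord hw.cj.1 l)
    (hw.cj.2.comp_left (g := fun a : C3 => a l) rfl) _ _

/-- Read with a = ∇w: |∇w|² = |curl w|² + |div w|² plus null Lagrangians. The last terms are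
bracketed so that each integrates to zero by `integral_partialD_mul_comm`. -/
theorem sum_normSq_eq (a : Fin 3 → Fin 3 → ℂ) :
    ((∑ j, ∑ i, ‖a j i‖ ^ 2 : ℝ) : ℂ) =
      (((‖a 1 2 - a 2 1‖ ^ 2 + ‖a 2 0 - a 0 2‖ ^ 2 + ‖a 0 1 - a 1 0‖ ^ 2 : ℝ)) : ℂ) +
      (a 0 0 + a 1 1 + a 2 2) * star (a 0 0 + a 1 1 + a 2 2) +
      ((a 1 2 * star (a 2 1) - a 2 2 * star (a 1 1)) + (a 2 1 * star (a 1 2) - a 1 1 * star (a 2 2)) +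
       (a 2 0 * star (a 0 2) - a 0 0 * star (a 2 2)) + (a 0 2 * star (a 2 0) - a 2 2 * star (a 0 0)) +
       (a 0 1 * star (a 1 0) - a 1 1 * star (a 0 0)) +
       (a 1 0 * star (a 0 1) - a 0 0 * star (a 1 1))) := by
  have h : ∀ z : ℂ, ((‖z‖ : ℂ)) ^ 2 = z * star z := fun z => (Complex.mul_conj' z).symm
  simp only [Fin.sum_univ_three]
  push_cast
  simp only [h, star_add, star_sub]
  ring

theorem integral_add_six {h a b c d e f : E3 → ℂ} (hh : Integrable h) (ha : Integrable a)
    (hb : Integrable b) (hc : Integrable c) (hd : Integrable d) (he : Integrable e)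
    (hf : Integrable f) (ia : ∫ x, a x = 0) (ib : ∫ x, b x = 0) (ic : ∫ x, c x = 0)
    (id : ∫ x, d x = 0) (ie : ∫ x, e x = 0) (jf : ∫ x, f x = 0) :
    ∫ x, (h x + (a x + b x + c x + d x + e x + f x)) = ∫ x, h x := by
  have h2 := ha.add hb
  have h3 := h2.add hc
  have h4 := h3.add hd
  have h5 := h4.add he
  refine (integral_add hh (h5.add hf)).trans ?_
  rw [integral_add' h5 hf, integral_add' h4 he, integral_add' h3 hd, integral_add' h2 hc,
    integral_add' ha hb, ia, ib, ic, id, ie, jf]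
  simp

/-- For a divergence free test field, the full gradient is controlled by the curl. -/
theorem integral_grad_curl {v : E3 → C3} (hv : IsTestField v) :
    ∫ x, ∑ j, ∑ i, ‖partialD (curl v) j i x‖ ^ 2 = ∫ x, ‖curl (curl v) x‖ ^ 2 := by
  set w := curl v with hw
  have ht : IsTestField w := hv.curl
  have hc : ∀ j i, Continuous (partialD w j i) := fun j i => (contDiff_partialD ht.1 j i).continuous
  have hcs : ∀ j i, HasCompactSupport (partialD w j i) := fun j i =>
    (ht.2.fderiv ℝ).comp_left (g := fun L : E3 →L[ℝ] C3 => (L (stdE j)) i) (by simp)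
  have hI : ∀ i j k l, Integrable fun x => partialD w i k x * star (partialD w j l x) :=
    fun i j k l => Continuous.integrable_of_hasCompactSupport
      ((hc _ _).mul (continuous_star.comp (hc _ _))) (hcs i k).mul_right
  have hI2 : ∀ i j k l, ∫ x, (partialD w i k x * star (partialD w j l x) -
      partialD w j k x * star (partialD w i l x)) = 0 := fun i j k l => by
    rw [integral_sub (hI ..) (hI ..), integral_partialD_mul_comm ht, sub_self]
  have hS : ∀ i j k l, Integrable fun x => partialD w i k x * star (partialD w j l x) -
      partialD w j k x * star (partialD w i l x) := fun i j k l => (hI ..).sub (hI ..)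
  have hcc : Integrable fun x => ((‖curl w x‖ ^ 2 : ℝ) : ℂ) :=
    (integrable_norm_sq ht.curl.memLp).ofReal
  have hpt : ∀ x, ((∑ j, ∑ i, ‖partialD w j i x‖ ^ 2 : ℝ) : ℂ) = _ := fun x =>
    sum_normSq_eq fun j i => partialD w j i x
  have hn : ∀ x, ‖partialD w 1 2 x - partialD w 2 1 x‖ ^ 2 +
      ‖partialD w 2 0 x - partialD w 0 2 x‖ ^ 2 + ‖partialD w 0 1 x - partialD w 1 0 x‖ ^ 2 =
      ‖curl w x‖ ^ 2 := fun x => by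
    rw [norm_sq_eq_sum, Fin.sum_univ_three]; rfl
  have hdiv : ∀ x, partialD w 0 0 x + partialD w 1 1 x + partialD w 2 2 x = 0 := div_curl hv.1
  simp only [hn, hdiv, zero_mul, add_zero] at hpt
  have hmain : ∫ x, ((∑ j, ∑ i, ‖partialD w j i x‖ ^ 2 : ℝ) : ℂ) =
      ∫ x, ((‖curl w x‖ ^ 2 : ℝ) : ℂ) := by
    simp only [hpt]
    exact integral_add_six hcc (hS 1 2 2 1) (hS 2 1 1 2) (hS 2 0 0 2) (hS 0 2 2 0) (hS 0 1 1 0)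
      (hS 1 0 0 1) (hI2 ..) (hI2 ..) (hI2 ..) (hI2 ..) (hI2 ..) (hI2 ..)
  rw [integral_complex_ofReal, integral_complex_ofReal] at hmain
  exact_mod_cast hmain

end MaxwellITE

namespace MaxwellITE

open Filter Topology

/-! ### Pull-back of fields under a diffeomorphism -/

/-- The Jacobian entries `∂ᵢ Ψₐ`. -/
noncomputable def jac (Ψ : E3 → E3) (i a : Fin 3) (x : E3) : ℝ := (fderiv ℝ Ψ x (stdE i)) a

/-- The pull-back `(DΨ)ᵀ u ∘ Ψ`. -/
noncomputable def pull (Ψ : E3 → E3) (u : E3 → C3) (x : E3) : C3 :=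
  WithLp.toLp 2 fun i => ∑ a, (jac Ψ i a x : ℂ) * u (Ψ x) a

theorem pull_apply (Ψ : E3 → E3) (u : E3 → C3) (x : E3) (i : Fin 3) :
    pull Ψ u x i = ∑ a, (jac Ψ i a x : ℂ) * u (Ψ x) a := rfl

/-- The cofactor matrix of the Jacobian. -/
noncomputable def cofac (Ψ : E3 → E3) (k c : Fin 3) (x : E3) : ℝ :=
  -- Indices are cyclic in `Fin 3`, so the cofactor signs are built in.
  jac Ψ (k + 1) (c + 1) x * jac Ψ (k + 2) (c + 2) x -
    jac Ψ (k + 1) (c + 2) x * jac Ψ (k + 2) (c + 1) x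

theorem contDiff_jac {Ψ : E3 → E3} (h : ContDiff ℝ ∞ Ψ) (i a : Fin 3) : ContDiff ℝ ∞ (jac Ψ i a) :=
  (EuclideanSpace.proj (𝕜 := ℝ) a).contDiff.comp
    ((h.fderiv_right (m := ∞) (by simp)).clm_apply contDiff_const)

theorem contDiff_cofac {Ψ : E3 → E3} (h : ContDiff ℝ ∞ Ψ) (k c : Fin 3) :
    ContDiff ℝ ∞ (cofac Ψ k c) :=
  ((contDiff_jac h _ _).mul (contDiff_jac h _ _)).sub ((contDiff_jac h _ _).mul (contDiff_jac h _ _))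

theorem contDiff_pull {Ψ : E3 → E3} {u : E3 → C3} (h : ContDiff ℝ ∞ Ψ) (hu : ContDiff ℝ ∞ u) :
    ContDiff ℝ ∞ (pull Ψ u) := by
  refine contDiff_of_coord fun i => ?_
  simp only [pull_apply]
  exact ContDiff.sum fun a _ => (Complex.ofRealCLM.contDiff.comp (contDiff_jac h i a)).mul
    ((contDiff_coord hu a).comp h)

theorem jac_symm {Ψ : E3 → E3} (h : ContDiff ℝ ∞ Ψ) (i j a : Fin 3) (x : E3) :
    fderiv ℝ (jac Ψ i a) x (stdE j) = fderiv ℝ (jac Ψ j a) x (stdE i) := by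
  have e : ∀ i, jac Ψ i a = fun y => fderiv ℝ (fun y => Ψ y a) y (stdE i) := fun i => by
    funext y
    have h2 : HasFDerivAt (fun y => Ψ y a) _ y := (EuclideanSpace.proj (𝕜 := ℝ) a).hasFDerivAt.comp y
      (h.differentiable (by simp) y).hasFDerivAt
    rw [h2.fderiv]; rfl
  rw [e, e]
  exact fderiv_fderiv_comm ((EuclideanSpace.proj (𝕜 := ℝ) a).contDiff.comp h) x _ _

theorem eq_sum_stdE (v : E3) : v = ∑ b, v b • stdE b := by
  ext i; simp [Finset.sum_apply, Pi.single_apply]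

/-- The chain and product rule for a linear combination of components composed with `Ψ`. -/
theorem fderiv_sum_mul_comp {Ψ : E3 → E3} {u : E3 → C3} {A : Fin 3 → E3 → ℝ}
    (h : ContDiff ℝ ∞ Ψ) (hu : ContDiff ℝ ∞ u) (hA : ∀ a, ContDiff ℝ ∞ (A a)) (j : Fin 3) (x : E3) :
    fderiv ℝ (fun y => ∑ a, (A a y : ℂ) * u (Ψ y) a) x (stdE j) =
      ∑ a, ((fderiv ℝ (A a) x (stdE j) : ℝ) * u (Ψ x) a +
        A a x * ∑ b, (jac Ψ j b x : ℂ) * partialD u b a (Ψ x)) := by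
  have hterm : ∀ a, HasFDerivAt (fun y => (A a y : ℂ) * u (Ψ y) a)
      ((A a x : ℂ) • ((fderiv ℝ (fun y => u y a) (Ψ x)).comp (fderiv ℝ Ψ x)) +
        (u (Ψ x) a) • (Complex.ofRealCLM.comp (fderiv ℝ (A a) x))) x := fun a => by
    have h1 : HasFDerivAt (fun y => (A a y : ℂ)) (Complex.ofRealCLM.comp (fderiv ℝ (A a) x)) x :=
      Complex.ofRealCLM.hasFDerivAt.comp x ((hA a).differentiable (by simp) x).hasFDerivAt
    have h2 : HasFDerivAt (fun y => u (Ψ y) a) _ x :=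
      ((contDiff_coord hu a).differentiable (by simp) (Ψ x)).hasFDerivAt.comp x
        (h.differentiable (by simp) x).hasFDerivAt
    exact h1.mul h2
  have hs := HasFDerivAt.fun_sum (u := Finset.univ) fun a _ => hterm a
  rw [hs.fderiv]
  simp only [_root_.sum_apply]
  refine Finset.sum_congr rfl fun a _ => ?_
  have e : fderiv ℝ (fun y => u y a) (Ψ x) (fderiv ℝ Ψ x (stdE j)) =
      ∑ b, (jac Ψ j b x : ℂ) * partialD u b a (Ψ x) := by
    conv_lhs => rw [eq_sum_stdE (fderiv ℝ Ψ x (stdE j))]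
    rw [map_sum]
    refine Finset.sum_congr rfl fun b _ => ?_
    rw [map_smul, partialD_eq (hu.differentiable (by simp) _), Complex.real_smul]; rfl
  simp only [_root_.add_apply, _root_.smul_apply, ContinuousLinearMap.comp_apply, e,
    smul_eq_mul, Complex.ofRealCLM_apply]
  ring

theorem partialD_pull {Ψ : E3 → E3} {u : E3 → C3} (h : ContDiff ℝ ∞ Ψ) (hu : ContDiff ℝ ∞ u)
    (j i : Fin 3) (x : E3) :
    partialD (pull Ψ u) j i x = ∑ a, ((fderiv ℝ (jac Ψ i a) x (stdE j) : ℝ) * u (Ψ x) a +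
        jac Ψ i a x * ∑ b, (jac Ψ j b x : ℂ) * partialD u b a (Ψ x)) := by
  rw [partialD_eq ((contDiff_pull h hu).differentiable (by simp) x)]
  exact fderiv_sum_mul_comp h hu (fun a => contDiff_jac h i a) j x

/-- The second derivatives of Ψ cancel by symmetry, and the antisymmetrised products of first
derivatives group into cofactors. This is why fields are pulled back as 1-forms and not merely
composed with Ψ. -/
theorem curl_pull {Ψ : E3 → E3} {u : E3 → C3} (h : ContDiff ℝ ∞ Ψ) (hu : ContDiff ℝ ∞ u)
    (x : E3) (k : Fin 3) :
    curl (pull Ψ u) x k = ∑ c, (cofac Ψ k c x : ℂ) * curl u (Ψ x) c := by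
  fin_cases k
  · change partialD _ 1 2 x - partialD _ 2 1 x = _
    rw [partialD_pull h hu, partialD_pull h hu]
    simp only [jac_symm h 2 1, Fin.sum_univ_three, cofac, curl_zero_apply, curl_one_apply,
      curl_two_apply]
    simp
    ring
  · change partialD _ 2 0 x - partialD _ 0 2 x = _
    rw [partialD_pull h hu, partialD_pull h hu]
    simp only [jac_symm h 2 0, Fin.sum_univ_three, cofac, curl_zero_apply, curl_one_apply,
      curl_two_apply]
    simp
    ring
  · change partialD _ 0 1 x - partialD _ 1 0 x = _
    rw [partialD_pull h hu, partialD_pull h hu]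
    simp only [jac_symm h 1 0, Fin.sum_univ_three, cofac, curl_zero_apply, curl_one_apply,
      curl_two_apply]
    simp
    ring

/-- Of u only curl u and its gradient appear, and of Ψ only first and second derivatives. -/
theorem partialD_curl_pull {Ψ : E3 → E3} {u : E3 → C3} (h : ContDiff ℝ ∞ Ψ) (hu : ContDiff ℝ ∞ u)
    (x : E3) (j k : Fin 3) :
    partialD (curl (pull Ψ u)) j k x =
      ∑ c, ((fderiv ℝ (cofac Ψ k c) x (stdE j) : ℝ) * curl u (Ψ x) c +
        cofac Ψ k c x * ∑ b, (jac Ψ j b x : ℂ) * partialD (curl u) b c (Ψ x)) := by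
  rw [partialD_eq ((contDiff_curl (contDiff_pull h hu)).differentiable (by simp) x)]
  simp only [curl_pull h hu]
  exact fderiv_sum_mul_comp h (contDiff_curl hu) (fun c => contDiff_cofac h k c) j x

/-- Bounds on the first and second derivatives of `Ψ`. -/
structure JacBound (Ψ : E3 → E3) : Prop where
  smooth : ContDiff ℝ ∞ Ψ
  first : ∀ i a x, |jac Ψ i a x| ≤ 2
  second : ∀ i a j x, |fderiv ℝ (jac Ψ i a) x (stdE j)| ≤ 1

theorem JacBound.abs_cofac_le {Ψ : E3 → E3} (h : JacBound Ψ) (k c : Fin 3) (x : E3) :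
    |cofac Ψ k c x| ≤ 8 := by
  have h2 : ∀ i a j b, |jac Ψ i a x * jac Ψ j b x| ≤ 4 := fun i a j b => by
    rw [abs_mul]
    nlinarith [h.first i a x, h.first j b x, abs_nonneg (jac Ψ i a x), abs_nonneg (jac Ψ j b x)]
  exact (abs_sub _ _).trans (by
    have e1 := h2 (k + 1) (c + 1) (k + 2) (c + 2)
    have e2 := h2 (k + 1) (c + 2) (k + 2) (c + 1)
    linarith)

theorem JacBound.abs_fderiv_cofac_le {Ψ : E3 → E3} (h : JacBound Ψ) (k c j : Fin 3) (x : E3) :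
    |fderiv ℝ (cofac Ψ k c) x (stdE j)| ≤ 8 := by
  have hd : ∀ i a, DifferentiableAt ℝ (jac Ψ i a) x := fun i a =>
    (contDiff_jac h.smooth i a).differentiable (by simp) x
  have h2 : ∀ i a i' b, |fderiv ℝ (fun y => jac Ψ i a y * jac Ψ i' b y) x (stdE j)| ≤ 4 :=
    fun i a i' b => by
      rw [fderiv_fun_mul (hd i a) (hd i' b)]
      simp only [_root_.add_apply, _root_.smul_apply, smul_eq_mul]
      refine (abs_add_le _ _).trans ?_
      rw [abs_mul, abs_mul]
      nlinarith [h.first i a x, h.first i' b x, h.second i a j x, h.second i' b j x,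
        abs_nonneg (jac Ψ i a x), abs_nonneg (jac Ψ i' b x),
        abs_nonneg (fderiv ℝ (jac Ψ i a) x (stdE j)), abs_nonneg (fderiv ℝ (jac Ψ i' b) x (stdE j))]
  have e : fderiv ℝ (cofac Ψ k c) x (stdE j) =
      fderiv ℝ (fun y => jac Ψ (k + 1) (c + 1) y * jac Ψ (k + 2) (c + 2) y) x (stdE j) -
      fderiv ℝ (fun y => jac Ψ (k + 1) (c + 2) y * jac Ψ (k + 2) (c + 1) y) x (stdE j) := by
    have : cofac Ψ k c = fun y => jac Ψ (k + 1) (c + 1) y * jac Ψ (k + 2) (c + 2) y -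
      jac Ψ (k + 1) (c + 2) y * jac Ψ (k + 2) (c + 1) y := rfl
    rw [this, fderiv_fun_sub ((hd _ _).fun_mul (hd _ _)) ((hd _ _).fun_mul (hd _ _))]; rfl
  rw [e]
  exact (abs_sub _ _).trans (by
    have e1 := h2 (k + 1) (c + 1) (k + 2) (c + 2)
    have e2 := h2 (k + 1) (c + 2) (k + 2) (c + 1)
    linarith)

theorem JacBound.norm_curl_curl_pull_le {Ψ : E3 → E3} (h : JacBound Ψ) {u : E3 → C3}
    (hu : ContDiff ℝ ∞ u) (x : E3) :
    ‖curl (curl (pull Ψ u)) x‖ ≤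
      144 * (‖curl u (Ψ x)‖ + ∑ b, ∑ c, ‖partialD (curl u) b c (Ψ x)‖) := by
  set S := ∑ b, ∑ c, ‖partialD (curl u) b c (Ψ x)‖ with hS
  -- The three values of c give 3 · 8 = 24 in front of ‖curl u‖ and 16 in front of S. A component of
  -- the outer curl is a difference of two such terms, hence 48, and three components give 144.
  have hp : ∀ j k, ‖partialD (curl (pull Ψ u)) j k x‖ ≤ 24 * (‖curl u (Ψ x)‖ + S) := fun j k => by
    rw [partialD_curl_pull h.smooth hu]
    have h1 : ∀ c, ‖((fderiv ℝ (cofac Ψ k c) x (stdE j) : ℝ) : ℂ) * curl u (Ψ x) c +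
        cofac Ψ k c x * ∑ b, (jac Ψ j b x : ℂ) * partialD (curl u) b c (Ψ x)‖ ≤
        8 * ‖curl u (Ψ x)‖ + 16 * ∑ b, ‖partialD (curl u) b c (Ψ x)‖ := fun c => by
      refine (norm_add_le _ _).trans (add_le_add ?_ ?_)
      · rw [norm_mul, Complex.norm_real]
        exact mul_le_mul (h.abs_fderiv_cofac_le k c j x) (norm_coord_le _ c) (norm_nonneg _)
          (by norm_num)
      · rw [norm_mul, Complex.norm_real]
        have h3 : ‖∑ b, (jac Ψ j b x : ℂ) * partialD (curl u) b c (Ψ x)‖ ≤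
            2 * ∑ b, ‖partialD (curl u) b c (Ψ x)‖ := by
          rw [Finset.mul_sum]
          refine norm_sum_le_of_le _ fun b _ => ?_
          rw [norm_mul, Complex.norm_real]
          exact mul_le_mul_of_nonneg_right (h.first j b x) (norm_nonneg _)
        calc _ ≤ 8 * (2 * ∑ b, ‖partialD (curl u) b c (Ψ x)‖) :=
              mul_le_mul (h.abs_cofac_le k c x) h3 (norm_nonneg _) (by norm_num)
          _ = _ := by ring
    refine (norm_sum_le_of_le _ fun c _ => h1 c).trans ?_
    rw [Finset.sum_add_distrib, ← Finset.mul_sum, ← Finset.mul_sum, Finset.sum_comm, ← hS]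
    have : 0 ≤ S := by positivity
    simp only [Finset.sum_const, Finset.card_univ, Fintype.card_fin, nsmul_eq_mul, Nat.cast_ofNat]
    linarith
  have hd : ∀ j k l m, ‖partialD (curl (pull Ψ u)) j k x - partialD (curl (pull Ψ u)) l m x‖ ≤
      48 * (‖curl u (Ψ x)‖ + S) := fun j k l m =>
    (norm_sub_le _ _).trans (by linarith [hp j k, hp l m])
  refine (norm_le_sum _).trans ?_
  have h0 := hd 1 2 2 1
  have h1 := hd 2 0 0 2
  have h2 := hd 0 1 1 0
  simp only [curl_zero_apply, curl_one_apply, curl_two_apply]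
  linarith

/-- There is a constant bounding the distortion of volume by a map that is antilipschitz with
constant `2`. -/
theorem exists_map_volume_le :
    ∃ M : NNReal, ∀ Ψ : E3 → E3, Measurable Ψ → AntilipschitzWith 2 Ψ →
      (volume : Measure E3).map Ψ ≤ M • volume := by
  have hfin : Module.finrank ℝ E3 = 3 := by simp
  have hH : (Measure.hausdorffMeasure 3 : Measure E3).IsAddHaarMeasure := by
    have := MeasureTheory.isAddHaarMeasure_hausdorffMeasure (E := E3)
    rwa [hfin] at this
  have hv := Measure.isAddLeftInvariant_eq_smul (volume : Measure E3)
    (Measure.hausdorffMeasure 3 : Measure E3)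
  -- Here 8 = 2 ^ 3: preimages under a 2-antilipschitz map enlarge three-dimensional Hausdorff
  -- measure at most by this factor, and volume is a multiple of that measure. No change of
  -- variables is needed.
  refine ⟨8, fun Ψ hm ha => Measure.le_iff.2 fun s hs => ?_⟩
  rw [Measure.map_apply hm hs, Measure.smul_apply]
  have h1 : Measure.hausdorffMeasure 3 (Ψ ⁻¹' s) ≤ 8 * Measure.hausdorffMeasure 3 s := by
    refine (ha.hausdorffMeasure_preimage_le (d := 3) (by norm_num) s).trans_eq ?_
    norm_num
  rw [hv, Measure.smul_apply, Measure.smul_apply]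
  simp only [ENNReal.smul_def, smul_eq_mul]
  rw [mul_left_comm]
  exact mul_le_mul_right h1 _

end MaxwellITE

namespace MaxwellITE

open Filter Topology

/-! ### Inward vector fields -/

/-- `ρ` is a local defining function of `D` near `x`. -/
structure IsChart (D : Set E3) (x : E3) (U : Set E3) (ρ : E3 → ℝ) : Prop where
  isOpen : IsOpen U
  mem : x ∈ U
  contDiffOn : ContDiffOn ℝ 2 ρ U
  fderiv_ne : fderiv ℝ ρ x ≠ 0
  eq : D ∩ U = {y ∈ U | ρ y < 0}

/-- The vector `v` points into `D` at `x`. -/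
def Inward (D : Set E3) (x v : E3) : Prop :=
  ∀ U ρ, IsChart D x U ρ → fderiv ℝ ρ x v < 0

namespace IsChart

variable {D U : Set E3} {ρ : E3 → ℝ} {x y : E3}

theorem mem_iff (h : IsChart D x U ρ) (hy : y ∈ U) : y ∈ D ↔ ρ y < 0 := by
  have := Set.ext_iff.1 h.eq y
  simpa [hy] using this

theorem contDiffAt (h : IsChart D x U ρ) (hy : y ∈ U) : ContDiffAt ℝ 2 ρ y :=
  h.contDiffOn.contDiffAt (h.isOpen.mem_nhds hy)

theorem nonpos_of_mem_closure (h : IsChart D x U ρ) (hy : y ∈ U) (hc : y ∈ closure D) :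
    ρ y ≤ 0 := by
  by_contra! hpos
  have h1 : ∀ᶠ z in 𝓝 y, 0 < ρ z :=
    (h.contDiffAt hy).continuousAt.eventually (lt_mem_nhds hpos)
  have h2 : ∀ᶠ z in 𝓝 y, z ∈ U := h.isOpen.mem_nhds hy
  obtain ⟨z, ⟨hz1, hz2⟩, hzD⟩ := mem_closure_iff_nhds.1 hc _ (h1.and h2)
  exact lt_asymm hz1 ((h.mem_iff hz2).1 hzD)

theorem eq_zero_of_mem_frontier (h : IsChart D x U ρ) (hD : IsOpen D) (hy : y ∈ U)
    (hf : y ∈ frontier D) : ρ y = 0 := by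
  rw [hD.frontier_eq] at hf
  refine le_antisymm (h.nonpos_of_mem_closure hy hf.1) ?_
  by_contra! hlt
  exact hf.2 ((h.mem_iff hy).2 hlt)

theorem eventually_neg (h : IsChart D x U ρ) (h0 : ρ x = 0) {v : E3} (hv : fderiv ℝ ρ x v < 0) :
    ∀ᶠ s : ℝ in 𝓝[>] 0, ρ (x + s • v) < 0 := by
  have hd : HasFDerivAt ρ (fderiv ℝ ρ x) x :=
    ((h.contDiffAt h.mem).differentiableAt (by simp)).hasFDerivAt
  have hl : HasDerivAt (fun s : ℝ => ρ (x + s • v)) (fderiv ℝ ρ x v) 0 := hd.hasLineDerivAt v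
  have ht := (hasDerivAt_iff_tendsto_slope.1 hl).mono_left
    (nhdsWithin_mono 0 fun s (hs : s ∈ Set.Ioi (0 : ℝ)) => ne_of_gt hs)
  filter_upwards [ht.eventually (gt_mem_nhds hv), self_mem_nhdsWithin] with s hs hs0
  rw [slope_def_field] at hs
  simp only [zero_smul, add_zero, h0, sub_zero] at hs
  by_contra! hge
  exact absurd hs (not_lt.2 (div_nonneg hge (le_of_lt hs0)))

theorem eventually_pos (h : IsChart D x U ρ) (h0 : ρ x = 0) {v : E3} (hv : 0 < fderiv ℝ ρ x v) :
    ∀ᶠ s : ℝ in 𝓝[>] 0, 0 < ρ (x + s • v) := by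
  have hd : HasFDerivAt ρ (fderiv ℝ ρ x) x :=
    ((h.contDiffAt h.mem).differentiableAt (by simp)).hasFDerivAt
  have hl : HasDerivAt (fun s : ℝ => ρ (x + s • v)) (fderiv ℝ ρ x v) 0 := hd.hasLineDerivAt v
  have ht := (hasDerivAt_iff_tendsto_slope.1 hl).mono_left
    (nhdsWithin_mono 0 fun s (hs : s ∈ Set.Ioi (0 : ℝ)) => ne_of_gt hs)
  filter_upwards [ht.eventually (lt_mem_nhds hv), self_mem_nhdsWithin] with s hs hs0
  rw [slope_def_field] at hs
  simp only [zero_smul, add_zero, h0, sub_zero] at hs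
  by_contra! hge
  exact absurd hs (not_lt.2 (div_nonpos_of_nonpos_of_nonneg hge (le_of_lt hs0)))

/-- Otherwise x + s v would, for small s > 0, lie in D according to one chart and outside D
according to the other. -/
theorem fderiv_nonpos (hD : IsOpen D) (hx : x ∈ frontier D) {U₁ U₂ : Set E3} {ρ₁ ρ₂ : E3 → ℝ}
    (h₁ : IsChart D x U₁ ρ₁) (h₂ : IsChart D x U₂ ρ₂) {v : E3} (hv : fderiv ℝ ρ₁ x v < 0) :
    fderiv ℝ ρ₂ x v ≤ 0 := by
  by_contra! hpos
  have hc : Tendsto (fun s : ℝ => x + s • v) (𝓝[>] 0) (𝓝 x) := by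
    have : Continuous fun s : ℝ => x + s • v := by fun_prop
    simpa using (this.tendsto 0).mono_left nhdsWithin_le_nhds
  have e1 := h₁.eventually_neg (h₁.eq_zero_of_mem_frontier hD h₁.mem hx) hv
  have e2 := h₂.eventually_pos (h₂.eq_zero_of_mem_frontier hD h₂.mem hx) hpos
  obtain ⟨s, ⟨⟨hs1, hs2⟩, hU1⟩, hU2⟩ := (((e1.and e2).and
    (hc.eventually (h₁.isOpen.mem_nhds h₁.mem))).and
    (hc.eventually (h₂.isOpen.mem_nhds h₂.mem))).exists
  exact lt_asymm hs2 ((h₂.mem_iff hU2).1 ((h₁.mem_iff hU1).2 hs1))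

theorem inward (h : IsChart D x U ρ) (hD : IsOpen D) (hx : x ∈ frontier D) {v : E3}
    (hv : fderiv ℝ ρ x v < 0) : Inward D x v := by
  intro U₂ ρ₂ h₂
  refine lt_of_le_of_ne (fderiv_nonpos hD hx h h₂ hv) fun h0 => ?_
  obtain ⟨a, ha⟩ : ∃ a, 0 < fderiv ℝ ρ₂ x a := by
    obtain ⟨a, ha⟩ := ContinuousLinearMap.exists_ne_zero h₂.fderiv_ne
    rcases lt_or_gt_of_ne ha with h | h
    · exact ⟨-a, by simpa using h⟩
    -- If the derivative in the second chart vanished at v, adding a small multiple of a would make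
    -- it positive while keeping it negative in the first chart, against `fderiv_nonpos`.
    · exact ⟨a, h⟩
  have hc : Tendsto (fun s : ℝ => fderiv ℝ ρ x (v + s • a)) (𝓝[>] 0) (𝓝 (fderiv ℝ ρ x v)) := by
    have : Continuous fun s : ℝ => fderiv ℝ ρ x (v + s • a) := by fun_prop
    simpa using (this.tendsto 0).mono_left nhdsWithin_le_nhds
  obtain ⟨s, hs, hs0⟩ := ((hc.eventually (gt_mem_nhds hv)).and self_mem_nhdsWithin).exists
  have := fderiv_nonpos hD hx h h₂ hs
  rw [map_add, map_smul, h0, zero_add, smul_eq_mul] at this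
  exact absurd this (not_le.2 (mul_pos hs0 ha))

/-- Moving points outside `D` against an inward field leads away from the closure of `D`. -/
theorem eventually_notMem_closure (h : IsChart D x U ρ) {X : E3 → E3} (hX : Continuous X) (hv : fderiv ℝ ρ x (X x) < 0) :
    ∀ᶠ p : ℝ × E3 in 𝓝 (0 : ℝ) ×ˢ 𝓝 x,
      0 < p.1 → p.2 ∉ D → p.2 - p.1 • X p.2 ∉ closure D := by
  rw [← nhds_prod_eq]
  set L := fderiv ℝ ρ x with hL
  set m := -L (X x) with hm
  have hm0 : 0 < m := neg_pos.2 hv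
  -- Strict differentiability is needed because the base point `p.2` moves together with the time
  -- `p.1`.
  have hst : HasStrictFDerivAt ρ L x := (h.contDiffAt h.mem).hasStrictFDerivAt (by simp)
  -- With this c the linearisation error is at most t m/4, whereas the linear term increases ρ by
  -- more than t m/2. Thus ρ > 0 at the displaced point, which excludes the closure of D.
  set c := m / (4 * (‖X x‖ + 1)) with hc
  have hc0 : 0 < c := by positivity
  have ho := hst.isLittleO.def hc0
  have hcont : Continuous fun p : ℝ × E3 => (p.2 - p.1 • X p.2, p.2) := by fun_prop
  have ht : Tendsto (fun p : ℝ × E3 => (p.2 - p.1 • X p.2, p.2)) (𝓝 (0, x)) (𝓝 (x, x)) := by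
    simpa using hcont.tendsto (0, x)
  have e1 := ht.eventually ho
  have ht1 : Tendsto (fun p : ℝ × E3 => p.2 - p.1 • X p.2) (𝓝 (0, x)) (𝓝 x) :=
    (continuous_fst.tendsto (x, x)).comp ht
  have e2 := ht1.eventually (h.isOpen.mem_nhds h.mem)
  have e3 : ∀ᶠ p : ℝ × E3 in 𝓝 (0, x), p.2 ∈ U :=
    (continuous_snd.tendsto ((0 : ℝ), x)).eventually (h.isOpen.mem_nhds h.mem)
  have e4 : ∀ᶠ p : ℝ × E3 in 𝓝 (0, x), L (X p.2) < -(m / 2) := by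
    have : Continuous fun p : ℝ × E3 => L (X p.2) := by fun_prop
    refine (this.tendsto (0, x)).eventually (gt_mem_nhds ?_)
    linarith
  have e5 : ∀ᶠ p : ℝ × E3 in 𝓝 (0, x), ‖X p.2‖ < ‖X x‖ + 1 := by
    have : Continuous fun p : ℝ × E3 => ‖X p.2‖ := by fun_prop
    exact (this.tendsto (0, x)).eventually (gt_mem_nhds (by simp))
  filter_upwards [e1, e2, e3, e4, e5] with p h1 h2 h3 h4 h5 ht0 hpD hcl
  have hle := h.nonpos_of_mem_closure h2 hcl
  have hge : 0 ≤ ρ p.2 := by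
    by_contra! hlt
    exact hpD ((h.mem_iff h3).2 hlt)
  have e : p.2 - p.1 • X p.2 - p.2 = -(p.1 • X p.2) := by abel
  simp only [e, map_neg, map_smul, norm_neg, norm_smul, Real.norm_eq_abs, abs_of_pos ht0,
    smul_eq_mul] at h1
  have h6 := neg_abs_le (ρ (p.2 - p.1 • X p.2) - ρ p.2 - -(p.1 * L (X p.2)))
  have h7 : c * (p.1 * ‖X p.2‖) ≤ p.1 * (m / 4) := by
    have : c * ‖X p.2‖ ≤ c * (‖X x‖ + 1) := mul_le_mul_of_nonneg_left h5.le hc0.le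
    have e' : c * (‖X x‖ + 1) = m / 4 := by
      rw [hc]; field_simp
    rw [e'] at this
    calc c * (p.1 * ‖X p.2‖) = p.1 * (c * ‖X p.2‖) := by ring
      _ ≤ _ := mul_le_mul_of_nonneg_left this ht0.le
  have h8 : p.1 * L (X p.2) < p.1 * -(m / 2) := mul_lt_mul_of_pos_left h4 ht0
  nlinarith [mul_pos ht0 hm0]

end IsChart

theorem HasC2Boundary.exists_isChart {D : Set E3} (h : HasC2Boundary D) {x : E3}
    (hx : x ∈ frontier D) : ∃ U ρ, IsChart D x U ρ := by
  obtain ⟨U, ρ, h1, h2, h3, h4, h5⟩ := h x hx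
  exact ⟨U, ρ, h1, h2, h3, h4, h5⟩

/-- By continuity of dρ a single vector works at all nearby boundary points, and by `IsChart.inward`
the sign in this one chart decides for every chart. -/
theorem exists_local_inward {D : Set E3} (hD : IsOpen D) (h : HasC2Boundary D) {x : E3}
    (hx : x ∈ frontier D) :
    ∃ v : E3, ∃ r > 0, ∀ y ∈ Metric.ball x r, y ∈ frontier D → Inward D y v := by
  obtain ⟨U, ρ, hc⟩ := h.exists_isChart hx
  obtain ⟨v, hv⟩ : ∃ v, fderiv ℝ ρ x v < 0 := by
    obtain ⟨a, ha⟩ := ContinuousLinearMap.exists_ne_zero hc.fderiv_ne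
    rcases lt_or_gt_of_ne ha with h | h
    · exact ⟨a, h⟩
    · exact ⟨-a, by simpa using h⟩
  have hcont : ContinuousAt (fun y => fderiv ℝ ρ y v) x :=
    ((hc.contDiffOn.continuousOn_fderiv_of_isOpen hc.isOpen (by simp)).continuousAt
      (hc.isOpen.mem_nhds hc.mem)).clm_apply continuousAt_const
  obtain ⟨r, hr, hb⟩ := Metric.eventually_nhds_iff_ball.1
    ((hcont.eventually (gt_mem_nhds hv)).and (hc.isOpen.mem_nhds hc.mem))
  refine ⟨v, r, hr, fun y hy hyf => ?_⟩
  obtain ⟨h1, h2⟩ := hb y hy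
  have hcy : IsChart D y U ρ := ⟨hc.isOpen, h2, hc.contDiffOn, fun h0 => by simp [h0] at h1, hc.eq⟩
  exact hcy.inward hD hyf h1

/-- A bounded `C²` domain has a smooth compactly supported field pointing inwards along its
boundary. -/
theorem exists_inward_field {D : Set E3} (hD : IsOpen D) (hb : Bornology.IsBounded D)
    (h : HasC2Boundary D) :
    ∃ X : E3 → E3, ContDiff ℝ ∞ X ∧ HasCompactSupport X ∧ ∀ x ∈ frontier D, Inward D x (X x) := by
  have hK : IsCompact (frontier D) := hb.isCompact_closure.of_isClosed_subset isClosed_frontier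
    frontier_subset_closure
  have hloc : ∀ x : E3, ∃ v : E3, ∃ r > 0, x ∈ frontier D →
      ∀ y ∈ Metric.ball x r, y ∈ frontier D → Inward D y v := fun x => by
    by_cases hx : x ∈ frontier D
    · obtain ⟨v, r, hr, hh⟩ := exists_local_inward hD h hx
      exact ⟨v, r, hr, fun _ => hh⟩
    · exact ⟨0, 1, one_pos, fun hx' => absurd hx' hx⟩
  choose v r hr hin using hloc
  let f : ∀ x : E3, ContDiffBump x := fun x =>
    ⟨r x / 2, r x, half_pos (hr x), half_lt_self (hr x)⟩
  obtain ⟨s, hsf, hs⟩ := hK.elim_nhds_subcover (fun x => Metric.ball x (r x / 2))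
    (fun x _ => Metric.ball_mem_nhds x (half_pos (hr x)))
  refine ⟨fun y => ∑ x ∈ s, f x y • v x, ?_, ?_, fun y hy U ρ hc => ?_⟩
  · exact ContDiff.sum fun x _ => (f x).contDiff.smul contDiff_const
  · have hcl : IsCompact (⋃ x ∈ s, tsupport (f x)) :=
      s.isCompact_biUnion fun x _ => (f x).hasCompactSupport.isCompact
    refine HasCompactSupport.intro hcl fun y hy => Finset.sum_eq_zero fun x hx => ?_
    have : y ∉ tsupport (f x) := fun hy' => hy (Set.mem_biUnion hx hy')
    rw [image_eq_zero_of_notMem_tsupport this, zero_smul]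
  -- In a given chart the inward vectors form an open half-space, so the bump-weighted sum stays
  -- inward as soon as one weight is positive; the subcover by half-radius balls guarantees one.
  · rw [map_sum]
    simp only [map_smul, smul_eq_mul]
    have hle : ∀ x ∈ s, f x y * fderiv ℝ ρ y (v x) ≤ 0 := fun x hx => by
      by_cases hyx : y ∈ Metric.ball x (r x)
      · exact mul_nonpos_of_nonneg_of_nonpos (f x).nonneg (hin x (hsf x hx) y hyx hy U ρ hc).le
      · have : f x y = 0 := (f x).zero_of_le_dist (not_lt.1 hyx)
        rw [this, zero_mul]
    obtain ⟨x, hxs, hyx⟩ := Set.mem_iUnion₂.1 (hs hy)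
    have hyx' : y ∈ Metric.ball x (r x) :=
      Metric.ball_subset_ball (half_le_self (hr x).le) hyx
    refine Finset.sum_neg' hle ⟨x, hxs, ?_⟩
    exact mul_neg_of_pos_of_neg ((f x).pos_of_mem_ball hyx') (hin x (hsf x hxs) y hyx' hy U ρ hc)

/-- For small positive times, the backward displacement along an inward field maps the complement
of `D` off the closure of `D`. -/
theorem eventually_forall_notMem_closure {D : Set E3} (hD : IsOpen D) (h : HasC2Boundary D)
    {X : E3 → E3} (hX : Continuous X) (hXs : HasCompactSupport X)
    (hin : ∀ x ∈ frontier D, Inward D x (X x)) :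
    ∀ᶠ t : ℝ in 𝓝 0, 0 < t → ∀ x ∉ D, x - t • X x ∉ closure D := by
  -- Compactness of the support of X makes the local time thresholds uniform.
  have hcomp := hXs.isCompact.eventually_forall_of_forall_eventually (x₀ := (0 : ℝ))
    (P := fun t x => 0 < t → x ∉ D → x - t • X x ∉ closure D) fun x _ => by
      rw [nhds_prod_eq]
      by_cases hxc : x ∈ closure D
      · by_cases hxD : x ∈ D
        · filter_upwards [prod_mem_prod univ_mem (hD.mem_nhds hxD)] with p hp _ hp2
          exact absurd hp.2 hp2
        · have hxf : x ∈ frontier D := by rw [hD.frontier_eq]; exact ⟨hxc, hxD⟩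
          obtain ⟨U, ρ, hc⟩ := h.exists_isChart hxf
          exact hc.eventually_notMem_closure hX (hin x hxf U ρ hc)
      · have hcont : Continuous fun p : ℝ × E3 => p.2 - p.1 • X p.2 := by fun_prop
        have ht : Tendsto (fun p : ℝ × E3 => p.2 - p.1 • X p.2) (𝓝 0 ×ˢ 𝓝 x) (𝓝 x) := by
          rw [← nhds_prod_eq]; simpa using hcont.tendsto (0, x)
        filter_upwards [ht.eventually (isClosed_closure.isOpen_compl.mem_nhds hxc)] with p hp _ _
        exact hp
  filter_upwards [hcomp] with t ht ht0 x hxD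
  by_cases hx : x ∈ tsupport X
  · exact ht x hx ht0 hxD
  -- Where X vanishes the point does not move, and it is not on the boundary since an inward vector
  -- is nonzero.
  · have h0 := image_eq_zero_of_notMem_tsupport hx
    rw [h0, smul_zero, sub_zero]
    intro hxc
    have hxf : x ∈ frontier D := by rw [hD.frontier_eq]; exact ⟨hxc, hxD⟩
    obtain ⟨U, ρ, hc⟩ := h.exists_isChart hxf
    have := hin x hxf U ρ hc
    rw [h0, map_zero] at this
    exact lt_irrefl _ this

end MaxwellITE

namespace MaxwellITE

open Filter Topology

/-! ### Approximation by test fields -/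

theorem integral_comp_le {M : NNReal} {Ψ : E3 → E3} (hm : Measurable Ψ)
    (hM : (volume : Measure E3).map Ψ ≤ M • volume) {h : E3 → ℝ} (hc : Continuous h)
    (h0 : ∀ x, 0 ≤ h x) (hi : Integrable h) :
    Integrable (fun x => h (Ψ x)) ∧ ∫ x, h (Ψ x) ≤ M * ∫ x, h x := by
  have hi2 : Integrable h (M • volume) := hi.smul_measure_nnreal
  have hi3 : Integrable h ((volume : Measure E3).map Ψ) := hi2.mono_measure hM
  refine ⟨(integrable_map_measure hc.aestronglyMeasurable hm.aemeasurable).1 hi3, ?_⟩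
  rw [← integral_map hm.aemeasurable hc.aestronglyMeasurable]
  refine (integral_mono_measure hM (Eventually.of_forall h0) hi2).trans_eq ?_
  rw [integral_smul_nnreal_measure]; rfl

theorem nrm_comp_le {M : NNReal} {Ψ : E3 → E3} (hΨ : Continuous Ψ)
    (hM : (volume : Measure E3).map Ψ ≤ M • volume) {f : E3 → C3} (hf : IsTestField f) :
    MemLp (fun x => f (Ψ x)) 2 ∧ nrm (fun x => f (Ψ x)) ≤ √M * nrm f := by
  have h := integral_comp_le hΨ.measurable hM (h := fun x => ‖f x‖ ^ 2)
    (hf.1.continuous.norm.pow 2) (fun x => by positivity) (integrable_norm_sq hf.memLp)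
  have hmem : MemLp (fun x => f (Ψ x)) 2 :=
    (memLp_two_iff_integrable_sq_norm (hf.1.continuous.comp hΨ).aestronglyMeasurable).2 h.1
  refine ⟨hmem, abs_le_of_sq_le_sq' ?_ (mul_nonneg (Real.sqrt_nonneg _) (nrm_nonneg _)) |>.2⟩
  rw [mul_pow, Real.sq_sqrt M.coe_nonneg, nrm_sq_eq hmem, nrm_sq_eq hf.memLp]
  exact h.2

/-- The constant is 2 · 9: nine entries in the double sum, and a factor 2 for separating a. -/
theorem add_sum_sq_le (a : ℝ) (s : Fin 3 → Fin 3 → ℝ) :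
    (a + ∑ b, ∑ c, s b c) ^ 2 ≤ 18 * (a ^ 2 + ∑ b, ∑ c, s b c ^ 2) := by
  have h1 : (∑ b, ∑ c, s b c) ^ 2 ≤ 9 * ∑ b, ∑ c, s b c ^ 2 := by
    have h2 := sq_sum_le_card_mul_sum_sq (s := Finset.univ) (f := fun b => ∑ c, s b c)
    have h3 : ∑ b, (∑ c, s b c) ^ 2 ≤ ∑ b, 3 * ∑ c, s b c ^ 2 := Finset.sum_le_sum fun b _ => by
      simpa using sq_sum_le_card_mul_sum_sq (s := Finset.univ) (f := fun c => s b c)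
    rw [← Finset.mul_sum] at h3
    simp only [Finset.card_univ, Fintype.card_fin, Nat.cast_ofNat] at h2
    linarith
  nlinarith [sq_nonneg (a - ∑ b, ∑ c, s b c), sq_nonneg a]

/-- The double curl of a pull-back is bounded in `L²`. -/
theorem JacBound.nrm_curl_curl_pull_le {M : NNReal} {Ψ : E3 → E3} (h : JacBound Ψ)
    (hM : (volume : Measure E3).map Ψ ≤ M • volume) {u : E3 → C3} (hu : IsTestField u)
    (ht : IsTestField (pull Ψ u)) :
    nrm (curl (curl (pull Ψ u))) ^ 2 ≤
      144 ^ 2 * 18 * M * (nrm (curl u) ^ 2 + nrm (curl (curl u)) ^ 2) := by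
  set q : E3 → ℝ := fun y => ‖curl u y‖ ^ 2 + ∑ b, ∑ c, ‖partialD (curl u) b c y‖ ^ 2 with hq
  have hcp : ∀ b c, Continuous (partialD (curl u) b c) := fun b c =>
    (contDiff_partialD hu.curl.1 b c).continuous
  have hIs : Integrable fun y => ∑ b, ∑ c, ‖partialD (curl u) b c y‖ ^ 2 := by
    refine integrable_finsetSum _ fun b _ => integrable_finsetSum _ fun c _ => ?_
    refine Continuous.integrable_of_hasCompactSupport ((hcp b c).norm.pow 2) ?_
    exact (hu.curl.2.fderiv ℝ).comp_left
      (g := fun L : E3 →L[ℝ] C3 => ‖(L (stdE b)) c‖ ^ 2) (by simp)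
  have hqc : Continuous q := (hu.curl.1.continuous.norm.pow 2).add
    (continuous_finsetSum _ fun b _ => continuous_finsetSum _ fun c _ => (hcp b c).norm.pow 2)
  have hI := integral_comp_le h.smooth.continuous.measurable hM hqc (fun x => by positivity)
    ((integrable_norm_sq hu.curl.memLp).add hIs)
  -- Here the full gradient of curl u is traded for curl curl u.
  have hint : ∫ x, q x = nrm (curl u) ^ 2 + nrm (curl (curl u)) ^ 2 := by
    rw [nrm_sq_eq hu.curl.memLp, nrm_sq_eq hu.curl.curl.memLp, ← integral_grad_curl hu]
    exact integral_add (integrable_norm_sq hu.curl.memLp) hIs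
  rw [nrm_sq_eq ht.curl.curl.memLp]
  calc ∫ x, ‖curl (curl (pull Ψ u)) x‖ ^ 2 ≤ ∫ x, 144 ^ 2 * 18 * q (Ψ x) := by
        refine integral_mono (integrable_norm_sq ht.curl.curl.memLp) (hI.1.const_mul _) fun x => ?_
        have h1 := pow_le_pow_left₀ (norm_nonneg _) (h.norm_curl_curl_pull_le hu.1 x) 2
        rw [mul_pow] at h1
        have h2 := add_sum_sq_le ‖curl u (Ψ x)‖ fun b c => ‖partialD (curl u) b c (Ψ x)‖
        exact h1.trans ((mul_le_mul_of_nonneg_left h2 (by positivity)).trans_eq (by ring))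
    _ = 144 ^ 2 * 18 * ∫ x, q (Ψ x) := integral_const_mul _ _
    _ ≤ 144 ^ 2 * 18 * (M * ∫ x, q x) := mul_le_mul_of_nonneg_left hI.2 (by positivity)
    _ = _ := by rw [hint]; ring

/-- The displacement `x ↦ x - t X(x)`. -/
noncomputable def displ (X : E3 → E3) (t : ℝ) (x : E3) : E3 := x - t • X x

theorem contDiff_displ {X : E3 → E3} (hX : ContDiff ℝ ∞ X) (t : ℝ) : ContDiff ℝ ∞ (displ X t) :=
  contDiff_id.sub (hX.const_smul t)

theorem jac_displ {X : E3 → E3} (hX : ContDiff ℝ ∞ X) (t : ℝ) (i a : Fin 3) (x : E3) :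
    jac (displ X t) i a x = (if i = a then 1 else 0) - t * jac X i a x := by
  have h : HasFDerivAt (displ X t) (ContinuousLinearMap.id ℝ E3 - t • fderiv ℝ X x) x :=
    (hasFDerivAt_id x).sub ((hX.differentiable (by simp) x).hasFDerivAt.const_smul t)
  simp only [jac, h.fderiv]
  simp [eq_comm]

theorem exists_jac_bound {X : E3 → E3} (hX : ContDiff ℝ ∞ X) (hs : HasCompactSupport X) :
    ∃ B : ℝ, 0 < B ∧ (∀ i a x, |jac X i a x| ≤ B) ∧
      ∀ i a j x, |fderiv ℝ (jac X i a) x (stdE j)| ≤ B := by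
  have hcs : ∀ i a, HasCompactSupport (jac X i a) := fun i a =>
    (hs.fderiv ℝ).comp_left (g := fun L : E3 →L[ℝ] E3 => (L (stdE i)) a) (by simp)
  have h1 : ∀ i a, ∃ B, ∀ x, ‖jac X i a x‖ ≤ B := fun i a =>
    (hcs i a).exists_bound_of_continuous (contDiff_jac hX i a).continuous
  have h2 : ∀ i a j, ∃ B, ∀ x, ‖fderiv ℝ (jac X i a) x (stdE j)‖ ≤ B := fun i a j =>
    ((hcs i a).fderiv_apply ℝ _).exists_bound_of_continuous
      (((contDiff_jac hX i a).continuous_fderiv (by simp)).clm_apply continuous_const)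
  choose B1 hB1 using h1
  choose B2 hB2 using h2
  have n1 : ∀ i a, 0 ≤ B1 i a := fun i a => (norm_nonneg _).trans (hB1 i a 0)
  have n2 : ∀ i a j, 0 ≤ B2 i a j := fun i a j => (norm_nonneg _).trans (hB2 i a j 0)
  refine ⟨1 + ∑ i, ∑ a, (B1 i a + ∑ j, B2 i a j), ?_, fun i a x => ?_, fun i a j x => ?_⟩
  · have : 0 ≤ ∑ i, ∑ a, (B1 i a + ∑ j, B2 i a j) := Finset.sum_nonneg fun i _ =>
      Finset.sum_nonneg fun a _ => add_nonneg (n1 i a) (Finset.sum_nonneg fun j _ => n2 i a j)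
    linarith
  all_goals
    have m1 : (B1 i a + ∑ j, B2 i a j) ≤ ∑ i, ∑ a, (B1 i a + ∑ j, B2 i a j) := by
      refine (Finset.single_le_sum (f := fun a => B1 i a + ∑ j, B2 i a j) (fun a _ =>
        add_nonneg (n1 i a) (Finset.sum_nonneg fun j _ => n2 i a j)) (Finset.mem_univ a)).trans ?_
      exact Finset.single_le_sum (f := fun i => ∑ a, (B1 i a + ∑ j, B2 i a j)) (fun i _ =>
        Finset.sum_nonneg fun a _ =>
          add_nonneg (n1 i a) (Finset.sum_nonneg fun j _ => n2 i a j)) (Finset.mem_univ i)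
  · have := hB1 i a x
    have h3 : 0 ≤ ∑ j, B2 i a j := Finset.sum_nonneg fun j _ => n2 i a j
    rw [Real.norm_eq_abs] at this
    linarith
  · have := hB2 i a j x
    have h3 : B2 i a j ≤ ∑ j, B2 i a j :=
      Finset.single_le_sum (fun j _ => n2 i a j) (Finset.mem_univ j)
    rw [Real.norm_eq_abs] at this
    have := n1 i a
    linarith

/-- For small t the displacement is a perturbation of the identity: t B ≤ 1 gives the derivative
bounds 2 and 1, and t L ≤ 1/2 gives |x - y| ≤ 2|Ψx - Ψy|. -/
theorem eventually_jacBound_displ {X : E3 → E3} (hX : ContDiff ℝ ∞ X) (hs : HasCompactSupport X) :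
    ∀ᶠ t : ℝ in 𝓝[>] 0, JacBound (displ X t) ∧ AntilipschitzWith 2 (displ X t) := by
  obtain ⟨B, hB, h1, h2⟩ := exists_jac_bound hX hs
  obtain ⟨L, hL⟩ := hX.lipschitzWith_of_hasCompactSupport hs (by simp)
  have e1 : ∀ᶠ t : ℝ in 𝓝[>] 0, t < 1 / B :=
    nhdsWithin_le_nhds (gt_mem_nhds (by positivity))
  have e2 : ∀ᶠ t : ℝ in 𝓝[>] 0, t < 1 / (2 * (L + 1)) :=
    nhdsWithin_le_nhds (gt_mem_nhds (by positivity))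
  filter_upwards [e1, e2, self_mem_nhdsWithin] with t ht1 ht2 (ht0 : 0 < t)
  have htB : t * B ≤ 1 := by
    rw [lt_div_iff₀ hB] at ht1; exact ht1.le
  have hmul : ∀ r, |r| ≤ B → |t * r| ≤ 1 := fun r hr => by
    rw [abs_mul, abs_of_pos ht0]
    exact (mul_le_mul_of_nonneg_left hr ht0.le).trans htB
  refine ⟨⟨contDiff_displ hX t, fun i a x => ?_, fun i a j x => ?_⟩,
    AntilipschitzWith.of_le_mul_dist fun x y => ?_⟩
  · rw [jac_displ hX]
    refine (abs_sub _ _).trans ?_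
    have := hmul _ (h1 i a x)
    have h3 : |(if i = a then (1 : ℝ) else 0)| ≤ 1 := by split_ifs <;> simp
    linarith
  · have e : jac (displ X t) i a = fun x => (if i = a then 1 else 0) - t * jac X i a x := by
      funext x; exact jac_displ hX t i a x
    have hd : DifferentiableAt ℝ (jac X i a) x := (contDiff_jac hX i a).differentiable (by simp) x
    rw [e, fderiv_const_sub, fderiv_const_mul hd]
    simp only [_root_.neg_apply, _root_.smul_apply, smul_eq_mul, abs_neg]
    exact hmul _ (h2 i a j x)
  · have h3 := hL.dist_le_mul x y
    rw [dist_eq_norm, dist_eq_norm] at h3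
    rw [dist_eq_norm, dist_eq_norm]
    have e : x - y = (displ X t x - displ X t y) + t • (X x - X y) := by
      simp only [displ, smul_sub]; abel
    have h4 : ‖x - y‖ ≤ ‖displ X t x - displ X t y‖ + t * ‖X x - X y‖ := by
      conv_lhs => rw [e]
      refine (norm_add_le _ _).trans_eq ?_
      rw [norm_smul, Real.norm_eq_abs, abs_of_pos ht0]
    have h5 : t * ‖X x - X y‖ ≤ 1 / 2 * ‖x - y‖ := by
      have hLt : t * L ≤ 1 / 2 := by
        rw [lt_div_iff₀ (by positivity)] at ht2
        nlinarith
      calc t * ‖X x - X y‖ ≤ t * (L * ‖x - y‖) := mul_le_mul_of_nonneg_left h3 ht0.le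
        _ = (t * L) * ‖x - y‖ := by ring
        _ ≤ _ := mul_le_mul_of_nonneg_right hLt (norm_nonneg _)
    simp only [NNReal.coe_ofNat]
    linarith

theorem norm_pull_sub_le {X : E3 → E3} (hX : ContDiff ℝ ∞ X) {B t : ℝ} (ht : 0 < t)
    (hB : ∀ i a x, |jac X i a x| ≤ B) (u : E3 → C3) (x : E3) :
    ‖pull (displ X t) u x - u (displ X t x)‖ ≤ 9 * (t * B) * ‖u (displ X t x)‖ := by
  have hi : ∀ i, ‖(pull (displ X t) u x - u (displ X t x)) i‖ ≤
      3 * (t * B) * ‖u (displ X t x)‖ := fun i => by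
    have e : (pull (displ X t) u x - u (displ X t x)) i =
        ∑ a, -((t * jac X i a x : ℝ) : ℂ) * u (displ X t x) a := by
      rw [PiLp.sub_apply, pull_apply]
      simp only [jac_displ hX, Fin.sum_univ_three]
      fin_cases i <;> simp <;> ring
    rw [e]
    refine (norm_sum_le_of_le (f := fun a => -((t * jac X i a x : ℝ) : ℂ) * u (displ X t x) a)
      Finset.univ (n := fun _ => t * B * ‖u (displ X t x)‖) fun a _ => ?_).trans_eq ?_
    · rw [norm_mul, norm_neg, Complex.norm_real, Real.norm_eq_abs, abs_mul, abs_of_pos ht]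
      exact mul_le_mul (mul_le_mul_of_nonneg_left (hB i a x) ht.le) (norm_coord_le _ a)
        (norm_nonneg _) (mul_nonneg ht.le ((abs_nonneg _).trans (hB i a x)))
    · simp; ring
  refine (norm_le_sum _).trans ?_
  linarith [hi 0, hi 1, hi 2]

theorem isTestFieldIn_pull {D V : Set E3} (hb : Bornology.IsBounded D) {Ψ : E3 → E3}
    (hΨ : ContDiff ℝ ∞ Ψ) (hV : ∀ x ∉ D, Ψ x ∉ V) {u : E3 → C3} (hu : IsTestFieldIn V u) :
    IsTestFieldIn D (pull Ψ u) := by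
  have hsub : tsupport (pull Ψ u) ⊆ Ψ ⁻¹' tsupport u := by
    refine closure_minimal (fun x hx => ?_) ((isClosed_tsupport u).preimage hΨ.continuous)
    refine subset_tsupport u fun h0 => hx ?_
    ext i
    simp [pull_apply, h0]
  have hD : tsupport (pull Ψ u) ⊆ D := fun x hx => by
    by_contra hxD
    exact hV x hxD (hu.2 (hsub hx))
  exact ⟨⟨contDiff_pull hΨ hu.1.1, hb.isCompact_closure.of_isClosed_subset (isClosed_tsupport _)
    (hD.trans subset_closure)⟩, hD⟩

/-- Fields whose curl and double curl on the whole space are square integrable and which vanish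
outside `D` are approximated by test fields on `D` with bounded double curl. -/
theorem exists_isTestFieldIn_approx {D : Set E3} (hD : IsOpen D) (hb : Bornology.IsBounded D)
    (hC2 : HasC2Boundary D) {u w z : E3 → C3} (hu : MemLp u 2) (hw : MemLp w 2) (hz : MemLp z 2)
    (hu0 : ∀ x ∉ D, u x = 0) (h1 : ∀ φ, IsTestField φ → bl u (curl φ) = bl w φ)
    (h2 : ∀ φ, IsTestField φ → bl w (curl φ) = bl z φ) :
    ∃ C : ℝ, ∀ ε > 0, ∃ φ, IsTestFieldIn D φ ∧ nrm (φ - u) ≤ ε ∧ nrm (curl (curl φ)) ≤ C := by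
  obtain ⟨M, hM⟩ := exists_map_volume_le
  obtain ⟨X, hX, hXs, hXin⟩ := exists_inward_field hD hb hC2
  obtain ⟨B, hB, hB1, -⟩ := exists_jac_bound hX hXs
  have huc : tsupport u ⊆ closure D := closure_mono fun x hx => by
    by_contra hxD; exact hx (hu0 x hxD)
  have hus : HasCompactSupport u :=
    hb.isCompact_closure.of_isClosed_subset (isClosed_tsupport u) huc
  set K := √(M : ℝ) with hK
  have hK0 : 0 ≤ K := Real.sqrt_nonneg _
  -- The bound is independent of ε because mollification contracts the L² norms of w and z.
  refine ⟨√(144 ^ 2 * 18 * M * (nrm w ^ 2 + nrm z ^ 2)), fun ε hε => ?_⟩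
  -- A Lipschitz g stands in for u when comparing u ∘ Ψ with u; its Lipschitz constant is fixed
  -- before t is chosen.
  obtain ⟨g, hg, hug⟩ := exists_isTestField_nrm_sub_le hu (ε := ε / (8 * (K + 1))) (by positivity)
  obtain ⟨L, hL⟩ := hg.1.lipschitzWith_of_hasCompactSupport hg.2 (by simp)
  set Y : E3 → C3 := fun x => ‖X x‖ • (EuclideanSpace.single 0 1 : C3) with hY
  have hYm : MemLp Y 2 := by
    refine Continuous.memLp_of_hasCompactSupport (hX.continuous.norm.smul continuous_const) ?_
    exact hXs.comp_left (g := fun v : E3 => ‖v‖ • (EuclideanSpace.single 0 1 : C3)) (by simp)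
  have hYn : ∀ x, ‖Y x‖ = ‖X x‖ := fun x => by simp [hY, norm_smul]
  set c := 9 * B * K * nrm u + L * nrm Y with hc
  have hc0 : 0 ≤ c := by
    have := nrm_nonneg u
    have := nrm_nonneg Y
    positivity
  have e1 : ∀ᶠ t : ℝ in 𝓝[>] 0, t < ε / (8 * (c + 1)) :=
    nhdsWithin_le_nhds (gt_mem_nhds (by positivity))
  obtain ⟨t, ⟨⟨⟨hJ, hA⟩, hout⟩, htc⟩, ht0⟩ := ((((eventually_jacBound_displ hX hXs).and
    (nhdsWithin_le_nhds (eventually_forall_notMem_closure hD hC2 hX.continuous hXs hXin))).and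
    e1).and self_mem_nhdsWithin).exists
  have ht0 : 0 < t := ht0
  have hout := hout ht0
  set Ψ := displ X t with hΨ
  have hMΨ := hM Ψ hJ.smooth.continuous.measurable hA
  have hUC : UniformContinuous Ψ := uniformContinuous_id.sub
    ((hXs.uniformContinuous_of_continuous hX.continuous).const_smul t)
  -- The complement of Ψ(Dᶜ) is an open set containing the closure of D. A field supported there
  -- pulls back to one supported in D, so there is room to mollify u once t is fixed.
  have hcl : IsClosed (Ψ '' Dᶜ) :=
    (hA.isClosedEmbedding hUC).isClosedMap _ hD.isClosed_compl
  have hKV : closure D ⊆ (Ψ '' Dᶜ)ᶜ := by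
    rintro y hy ⟨x, hx, rfl⟩
    exact hout x hx hy
  have hev := eventually_isTestFieldIn_moll hcl.isOpen_compl hb.isCompact_closure hKV
  have hmt : ∀ᶠ n in atTop, nrm (moll n u - u) < ε / (8 * (K + 1)) :=
    (tendsto_moll hu).eventually (gt_mem_nhds (by positivity))
  obtain ⟨n, hn1, hn2⟩ := (hev.and hmt).exists
  have hV := hn1 u hu huc
  set v := moll n u with hv
  have hT : IsTestFieldIn D (pull Ψ v) := isTestFieldIn_pull (V := (Ψ '' Dᶜ)ᶜ) hb
    hJ.smooth (fun x hx hx' => hx' ⟨x, hx, rfl⟩) hV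
  have hvT : IsTestField v := hV.1
  refine ⟨pull Ψ v, hT, ?_, ?_⟩
  · obtain ⟨m1, b1⟩ := nrm_comp_le hJ.smooth.continuous hMΨ hvT
    have hvg : IsTestField (v - g) := ⟨hvT.1.sub hg.1, hvT.2.sub hg.2⟩
    obtain ⟨m2, b2⟩ := nrm_comp_le hJ.smooth.continuous hMΨ hvg
    obtain ⟨m3, -⟩ := nrm_comp_le hJ.smooth.continuous hMΨ hg
    -- The errors are, in order: Jacobian against identity, v against g after composition,
    -- displacement of the Lipschitz field g, and g against u.
    have e : pull Ψ v - u = ((pull Ψ v - fun x => v (Ψ x)) + (fun x => (v - g) (Ψ x))) +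
        (((fun x => g (Ψ x)) - g) + (g - u)) := by
      funext x; simp only [Pi.add_apply, Pi.sub_apply]; abel
    have t1 : nrm (pull Ψ v - fun x => v (Ψ x)) ≤ 9 * (t * B) * (K * nrm u) := by
      refine (nrm_le_of_norm_le m1 (Eventually.of_forall fun x =>
        norm_pull_sub_le hX ht0 hB1 v x) (by positivity)).trans ?_
      refine mul_le_mul_of_nonneg_left (b1.trans ?_) (by positivity)
      exact mul_le_mul_of_nonneg_left (nrm_moll_le hu n) hK0
    have t2 : nrm (fun x => (v - g) (Ψ x)) ≤ K * (ε / (8 * (K + 1)) + ε / (8 * (K + 1))) := by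
      refine b2.trans (mul_le_mul_of_nonneg_left ?_ hK0)
      have : v - g = (v - u) + (u - g) := by abel
      rw [this]
      exact (nrm_add_le (hvT.memLp.sub hu) (hu.sub hg.memLp)).trans (add_le_add hn2.le hug)
    have t3 : nrm ((fun x => g (Ψ x)) - g) ≤ L * t * nrm Y := by
      refine nrm_le_of_norm_le hYm (Eventually.of_forall fun x => ?_) (by positivity)
      have := hL.dist_le_mul (Ψ x) x
      rw [dist_eq_norm, dist_eq_norm] at this
      have e' : Ψ x - x = -(t • X x) := by simp only [hΨ, displ]; abel
      rw [e', norm_neg, norm_smul, Real.norm_eq_abs, abs_of_pos ht0] at this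
      rw [hYn, mul_assoc]
      exact this
    have t4 : nrm (g - u) ≤ ε / (8 * (K + 1)) := by rw [nrm_sub_comm]; exact hug
    have hp := hT.1.memLp
    have s1 := nrm_add_le (hp.sub m1) m2
    have s2 := nrm_add_le (m3.sub hg.memLp) (hg.memLp.sub hu)
    have s3 := nrm_add_le ((hp.sub m1).add m2) ((m3.sub hg.memLp).add (hg.memLp.sub hu))
    rw [e]
    have q1 : 9 * (t * B) * (K * nrm u) + L * t * nrm Y ≤ ε / 8 := by
      have : t * c ≤ ε / 8 := by
        rw [lt_div_iff₀ (by positivity)] at htc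
        nlinarith
      calc _ = t * c := by rw [hc]; ring
        _ ≤ _ := this
    have q2 : (K + 1) * (ε / (8 * (K + 1))) = ε / 8 := by
      field_simp
    have q3 : 0 ≤ ε / (8 * (K + 1)) := by positivity
    nlinarith
  · refine Real.le_sqrt_of_sq_le ((hJ.nrm_curl_curl_pull_le hMΨ hvT hT.1).trans ?_)
    have c1 : curl v = moll n w := curl_moll_of_weak hu hw h1 n
    have c2 : curl (curl v) = moll n z := by rw [c1]; exact curl_moll_of_weak hw hz h2 n
    rw [c2, c1]
    refine mul_le_mul_of_nonneg_left (add_le_add ?_ ?_) (by positivity)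
    · exact pow_le_pow_left₀ (nrm_nonneg _) (nrm_moll_le hw n) 2
    · exact pow_le_pow_left₀ (nrm_nonneg _) (nrm_moll_le hz n) 2

end MaxwellITE

namespace MaxwellITE

open Filter Topology

/-! ### Pairing weak solutions with `H₀(curl²)` -/

/-- Truncating F to a compact subset of D with small complement costs little by absolute continuity
of the integral; mollifying the truncation then keeps the support in D. -/
theorem exists_isTestFieldIn_nrm_sub_le {D : Set E3} (hD : IsOpen D) (hb : Bornology.IsBounded D)
    {F : E3 → C3} (hF : MemLp F 2) (hF0 : ∀ x ∉ D, F x = 0) {ε : ℝ} (hε : 0 < ε) :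
    ∃ θ, IsTestFieldIn D θ ∧ nrm (F - θ) ≤ ε := by
  obtain ⟨δ, hδ, hδ'⟩ := hF.eLpNorm_indicator_le (by norm_num) (by norm_num) (half_pos hε)
  obtain ⟨K, hKD, hK, hKμ⟩ := hD.measurableSet.exists_isCompact_sdiff_lt
    (μ := volume) hb.measure_lt_top.ne
    (ENNReal.ofReal_pos.2 hδ).ne'
  have h1 := hδ' (D \ K) (hD.measurableSet.diff hK.measurableSet) hKμ.le
  have hG : MemLp (K.indicator F) 2 := hF.indicator hK.measurableSet
  have hdiff : F - K.indicator F = (D \ K).indicator F := by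
    funext x
    by_cases hxK : x ∈ K
    · simp [hxK]
    · by_cases hxD : x ∈ D
      · simp [hxK, hxD]
      · simp [hxK, hxD, hF0 x hxD]
  have h2 : nrm (F - K.indicator F) ≤ ε / 2 := by
    rw [hdiff]
    exact ENNReal.toReal_le_of_le_ofReal (half_pos hε).le h1
  have hts : tsupport (K.indicator F) ⊆ K :=
    closure_minimal Set.support_indicator_subset hK.isClosed
  obtain ⟨n, hn1, hn2⟩ := ((eventually_isTestFieldIn_moll hD hK hKD).and
    ((tendsto_moll hG).eventually (gt_mem_nhds (half_pos hε)))).exists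
  refine ⟨moll n (K.indicator F), hn1 _ hG hts, ?_⟩
  have e : F - moll n (K.indicator F) =
      (F - K.indicator F) + (K.indicator F - moll n (K.indicator F)) := by abel
  rw [nrm_sub_comm] at hn2
  rw [e]
  exact (nrm_add_le (hF.sub hG) (hG.sub (memLp_moll hG n))).trans (by linarith)

/-- A field orthogonal to all test fields on `D` is orthogonal to all fields on `D`. -/
theorem bl_eq_zero_of_forall_isTestFieldIn {D : Set E3} (hD : IsOpen D)
    (hb : Bornology.IsBounded D) {H F : E3 → C3} (hH : MemLp H 2) (hF : MemLp F 2)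
    (hF0 : ∀ x ∉ D, F x = 0) (h : ∀ φ, IsTestFieldIn D φ → bl H φ = 0) : bl H F = 0 := by
  rw [← norm_le_zero_iff]
  refine le_of_forall_pos_le_add fun ε hε => ?_
  have hn : 0 < nrm H + 1 := by have := nrm_nonneg H; linarith
  obtain ⟨θ, hθ, hθε⟩ := exists_isTestFieldIn_nrm_sub_le hD hb hF hF0
    (ε := ε / (nrm H + 1)) (by positivity)
  have e : bl H F = bl H (F - θ) := by
    rw [bl_sub_right hF hθ.1.memLp hH, h θ hθ, sub_zero]
  rw [e, zero_add]
  refine (norm_bl_le hH (hF.sub hθ.1.memLp)).trans ?_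
  calc nrm H * nrm (F - θ) ≤ (nrm H + 1) * (ε / (nrm H + 1)) :=
        mul_le_mul (by linarith) hθε (nrm_nonneg _) hn.le
    _ = ε := by field_simp

/-- Weak solutions of `curl curl F + G = 0` in `D` may be tested with fields in `H₀(curl², D)`. -/
theorem bl_add_bl_eq_zero {D : Set E3} (hD : IsOpen D) (hb : Bornology.IsBounded D)
    (hC2 : HasC2Boundary D) {u w z F G : E3 → C3} (hu : MemLp u 2) (hw : MemLp w 2)
    (hz : MemLp z 2) (hF : MemLp F 2) (hG : MemLp G 2)
    (hu0 : ∀ x ∉ D, u x = 0) (hF0 : ∀ x ∉ D, F x = 0)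
    (h1 : ∀ φ, IsTestField φ → bl u (curl φ) = bl w φ)
    (h2 : ∀ φ, IsTestField φ → bl w (curl φ) = bl z φ)
    (h : ∀ φ, IsTestFieldIn D φ → bl F (curl (curl φ)) + bl G φ = 0) :
    bl F z + bl G u = 0 := by
  obtain ⟨C, hC⟩ := exists_isTestFieldIn_approx hD hb hC2 hu hw hz hu0 h1 h2
  rw [← norm_le_zero_iff]
  refine le_of_forall_pos_le_add fun ε hε => ?_
  rw [zero_add]
  have hn : 0 < nrm z + |C| + 1 := by have := nrm_nonneg z; positivity
  -- The order of choices matters: F - θ must be small against the uniform bound on curl curl φ, and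
  -- afterwards φ - u is made small against the now fixed norm of curl curl θ. Convergence of curl
  -- curl φ is never needed.
  obtain ⟨θ, hθ, hθε⟩ := exists_isTestFieldIn_nrm_sub_le hD hb hF hF0
    (ε := ε / (2 * (nrm z + |C| + 1))) (by positivity)
  set R := nrm (curl (curl θ)) + nrm G + 1 with hR
  have hR0 : 0 < R := by
    have := nrm_nonneg (curl (curl θ))
    have := nrm_nonneg G
    positivity
  obtain ⟨φ, hφ, hφu, hφC⟩ := hC (ε / (2 * R)) (by positivity)
  have mφ := hφ.1.memLp
  have mc := hφ.1.curl.curl.memLp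
  have mθ := hθ.1.memLp
  have mcθ := hθ.1.curl.curl.memLp
  have e1 : bl θ z = bl (curl (curl θ)) u := by
    rw [bl_comm θ, ← h2 θ hθ.1, ← h1 _ hθ.1.curl, bl_comm]
  have e2 : bl θ (curl (curl φ)) = bl (curl (curl θ)) φ := by
    rw [integral_dot_curl hθ.1.1 hφ.1.curl, integral_dot_curl hθ.1.curl.1 hφ.1]
  have e : bl F z + bl G u =
      bl (F - θ) (z - curl (curl φ)) - bl (curl (curl θ)) (φ - u) - bl G (φ - u) := by
    rw [bl_sub_left hF mθ (hz.sub mc), bl_sub_right hz mc hF, bl_sub_right hz mc mθ,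
      bl_sub_right mφ hu mcθ, bl_sub_right mφ hu hG, e1, e2]
    linear_combination h φ hφ
  rw [e]
  have b1 := norm_bl_le (hF.sub mθ) (hz.sub mc)
  have b2 := norm_bl_le mcθ (mφ.sub hu)
  have b3 := norm_bl_le hG (mφ.sub hu)
  have b4 := nrm_sub_le hz mc
  have c1 : nrm (F - θ) * nrm (z - curl (curl φ)) ≤ ε / 2 := by
    calc _ ≤ ε / (2 * (nrm z + |C| + 1)) * (nrm z + |C| + 1) :=
          mul_le_mul hθε (by linarith [le_abs_self C]) (nrm_nonneg _) (by positivity)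
      _ = ε / 2 := by field_simp
  have c2 : (nrm (curl (curl θ)) + nrm G) * nrm (φ - u) ≤ ε / 2 := by
    calc _ ≤ R * (ε / (2 * R)) :=
          mul_le_mul (by linarith) hφu (nrm_nonneg _) hR0.le
      _ = ε / 2 := by field_simp
  refine (norm_sub_le _ _).trans ?_
  have := norm_sub_le (bl (F - θ) (z - curl (curl φ))) (bl (curl (curl θ)) (φ - u))
  linarith

end MaxwellITE

namespace MaxwellITE

open Filter Topology

/-! ### The index of refraction -/

theorem act_apply (A : Matrix (Fin 3) (Fin 3) ℂ) (a : C3) (i : Fin 3) :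
    act A a i = ∑ j, A i j * a j := rfl

theorem act_sub (A : Matrix (Fin 3) (Fin 3) ℂ) (a b : C3) : act A (a - b) = act A a - act A b := by
  ext i; simp [act_apply, mul_sub]

@[simp] theorem act_one (a : C3) : act 1 a = a := by
  ext i; simp [act]

theorem act_smul_one (c : ℂ) (a : C3) : act (c • (1 : Matrix (Fin 3) (Fin 3) ℂ)) a = c • a := by
  ext i; simp [act, smul_mulVec]

@[simp] theorem act_zero (A : Matrix (Fin 3) (Fin 3) ℂ) : act A 0 = 0 := by
  ext i; simp [act_apply]

theorem norm_act_le {A : Matrix (Fin 3) (Fin 3) ℂ} {C : Fin 3 → Fin 3 → ℝ}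
    (h : ∀ i j, ‖A i j‖ ≤ C i j) (a : C3) : ‖act A a‖ ≤ (∑ i, ∑ j, C i j) * ‖a‖ := by
  have h1 : ∀ i, ‖act A a i‖ ≤ (∑ j, C i j) * ‖a‖ := fun i => by
    rw [act_apply, Finset.sum_mul]
    refine norm_sum_le_of_le _ fun j _ => ?_
    rw [norm_mul]
    exact mul_le_mul (h i j) (norm_coord_le a j) (norm_nonneg _) ((norm_nonneg _).trans (h i j))
  refine (norm_le_sum _).trans ?_
  rw [Fin.sum_univ_three (fun i => ∑ j, C i j), add_mul, add_mul]
  exact add_le_add (add_le_add (h1 0) (h1 1)) (h1 2)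

/-- By symmetry both real matrices Re A and Im A have real forms, so i Im A contributes only to the
imaginary part. -/
theorem re_dot_act_eq_form {A : Matrix (Fin 3) (Fin 3) ℂ} (hA : A.IsSymm) (a : C3) :
    (dot (act A a) (cj a)).re = form (A.map Complex.re) a := by
  have h10 : A 1 0 = A 0 1 := hA.apply 0 1
  have h20 : A 2 0 = A 0 2 := hA.apply 0 2
  have h21 : A 2 1 = A 1 2 := hA.apply 1 2
  simp [form, dot_eq, act_apply, dotProduct, mulVec, Fin.sum_univ_three, h10, h20, h21]
  ring

theorem form_real_smul (A : Matrix (Fin 3) (Fin 3) ℝ) (r : ℝ) (a : C3) :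
    form A (r • a) = r ^ 2 * form A a := by
  simp [form, dotProduct, mulVec, Fin.sum_univ_three]
  ring

theorem le_form_of_unit {A : Matrix (Fin 3) (Fin 3) ℝ} {α : ℝ}
    (h : ∀ a : C3, ‖a‖ = 1 → α ≤ form A a) (a : C3) : α * ‖a‖ ^ 2 ≤ form A a := by
  by_cases h0 : a = 0
  · simp [h0, form]
  · have hn : ‖a‖ ≠ 0 := norm_ne_zero_iff.2 h0
    have h1 := h (‖a‖⁻¹ • a) (by rw [norm_smul, norm_inv, norm_norm, inv_mul_cancel₀ hn])
    rw [form_real_smul] at h1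
    have h2 := mul_le_mul_of_nonneg_right h1 (sq_nonneg ‖a‖)
    rwa [mul_right_comm, inv_pow, inv_mul_cancel₀ (pow_ne_zero 2 hn), one_mul] at h2

theorem aestronglyMeasurable_act {μ : Measure E3} {N : E3 → Matrix (Fin 3) (Fin 3) ℂ} {E : E3 → C3}
    (hN : ∀ i j, AEStronglyMeasurable (fun x => N x i j) μ) (hE : AEStronglyMeasurable E μ) :
    AEStronglyMeasurable (fun x => act (N x) (E x)) μ := by
  have hc : ∀ j, AEStronglyMeasurable (fun x => E x j) μ := fun j =>
    (EuclideanSpace.proj (𝕜 := ℂ) j : C3 →L[ℂ] ℂ).continuous.comp_aestronglyMeasurable hE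
  have e : (fun x => act (N x) (E x)) =
      fun x => ∑ i, (∑ j, N x i j * E x j) • (EuclideanSpace.single i 1 : C3) := by
    funext x
    ext k
    simp [act_apply, Finset.sum_apply, Pi.single_apply]
  rw [e]
  exact Finset.aestronglyMeasurable_fun_sum _ fun i _ =>
    (Finset.aestronglyMeasurable_fun_sum _ fun j _ => (hN i j).mul (hc j)).smul_const _

namespace IndexAssumption

variable {D O : Set E3} {N : E3 → Matrix (Fin 3) (Fin 3) ℂ}

theorem exists_norm_act_le (h : IndexAssumption D O N) :
    ∃ C : ℝ, 0 ≤ C ∧ ∀ᵐ x ∂(volume.restrict D), ∀ a, ‖act (N x) a‖ ≤ C * ‖a‖ := by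
  have h1 : ∀ i j, ∃ C : ℝ, 0 ≤ C ∧ ∀ᵐ x ∂(volume.restrict D), ‖N x i j‖ ≤ C := fun i j => by
    refine ⟨(eLpNorm (fun x => N x i j) ⊤ (volume.restrict D)).toReal, ENNReal.toReal_nonneg, ?_⟩
    filter_upwards [ae_le_eLpNormEssSup (f := fun x => N x i j) (μ := volume.restrict D)] with x hx
    rw [← eLpNorm_exponent_top] at hx
    have := ENNReal.toReal_mono (h.bounded i j).2.ne hx
    rwa [toReal_enorm] at this
  choose C hC0 hC using h1
  refine ⟨∑ i, ∑ j, C i j, Finset.sum_nonneg fun i _ => Finset.sum_nonneg fun j _ => hC0 i j, ?_⟩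
  have : ∀ᵐ x ∂(volume.restrict D), ∀ i j, ‖N x i j‖ ≤ C i j :=
    ae_all_iff.2 fun i => ae_all_iff.2 fun j => hC i j
  filter_upwards [this] with x hx a using norm_act_le hx a

theorem memLp_act (h : IndexAssumption D O N) {E : E3 → C3} (hE : MemL2 D E) :
    MemL2 D fun x => act (N x) (E x) := by
  obtain ⟨C, -, hC⟩ := h.exists_norm_act_le
  refine MemLp.of_le_mul (c := C) hE
    (aestronglyMeasurable_act (fun i j => (h.bounded i j).1) hE.1) ?_
  filter_upwards [hC] with x hx using hx _

theorem exists_coercive (h : IndexAssumption D O N) :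
    ∃ α : ℝ, 0 < α ∧ ∀ᵐ x ∂(volume.restrict D), ∀ a,
      α * ‖a‖ ^ 2 ≤ (dot (act (N x) a) (cj a)).re := by
  obtain ⟨α, hα, h1⟩ := h.re_coercive
  refine ⟨α, hα, ?_⟩
  filter_upwards [h1, h.symm] with x hx hs a
  rw [re_dot_act_eq_form hs]
  exact le_form_of_unit hx a

end IndexAssumption

end MaxwellITE

namespace MaxwellITE

open Filter Topology

/-! ### Absence of transmission eigenvalues -/

theorem setIntegral_dot {D : Set E3} (hD : MeasurableSet D) (f g : E3 → C3) :
    ∫ x in D, dot (f x) (g x) = bl (D.indicator f) g := by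
  rw [bl, ← integral_indicator hD]
  refine integral_congr_ae (Eventually.of_forall fun x => ?_)
  by_cases hx : x ∈ D <;> simp [hx]

theorem MemL2.indicator {D : Set E3} (hD : MeasurableSet D) {f : E3 → C3} (hf : MemL2 D f) :
    MemLp (D.indicator f) 2 :=
  (memLp_indicator_iff_restrict hD).2 hf

theorem re_bl {f g : E3 → C3} (hf : MemLp f 2) (hg : MemLp g 2) :
    (bl f g).re = ∫ x, (dot (f x) (g x)).re :=
  (Complex.reCLM.integral_comp_comm (integrable_dot hf hg)).symm

theorem integrable_re_dot {f g : E3 → C3} (hf : MemLp f 2) (hg : MemLp g 2) :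
    Integrable fun x => (dot (f x) (g x)).re :=
  Complex.reCLM.integrable_comp (integrable_dot hf hg)

theorem bl_smul_left (c : ℂ) (f g : E3 → C3) : bl (c • f) g = c * bl f g := by
  simp only [bl, Pi.smul_apply, dot_smul_left]
  exact integral_const_mul _ _

/-- The squared `L²` norm over a set. -/
noncomputable def massOn (S : Set E3) (f : E3 → C3) : ℝ := ∫ x, S.indicator (fun y => ‖f y‖ ^ 2) x

theorem massOn_nonneg (S : Set E3) (f : E3 → C3) : 0 ≤ massOn S f :=
  integral_nonneg fun x => Set.indicator_nonneg (fun y _ => by positivity) x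

theorem nrm_sq_eq_massOn_add {D O : Set E3} (hD : MeasurableSet D) (hO : MeasurableSet O)
    {f : E3 → C3} (hf : MemLp f 2) (hf0 : ∀ x ∉ D, f x = 0) :
    nrm f ^ 2 = massOn O f + massOn (D \ O) f := by
  rw [nrm_sq_eq hf, massOn, massOn, ← integral_add ((integrable_norm_sq hf).indicator hO)
    ((integrable_norm_sq hf).indicator (hD.diff hO))]
  refine integral_congr_ae (Eventually.of_forall fun x => ?_)
  by_cases hxO : x ∈ O
  · simp [hxO]
  · by_cases hxD : x ∈ D
    · simp [hxO, hxD]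
    · simp [hxO, hxD, hf0 x hxD]

/-- For large spectral parameter, a weak solution has little mass away from the boundary. -/
theorem massOn_diff_le {D O : Set E3} (hD : IsOpen D) (hO : IsOpen O) {χ : E3 → ℝ}
    (hχ : ContDiff ℝ ∞ χ) (hχs : HasCompactSupport χ) (hχ1 : ∀ x ∈ D \ O, χ x = 1) {C : ℝ}
    (hC : ∀ F G : E3 → C3, MemLp F 2 → MemLp G 2 →
      (∀ φ, IsTestFieldIn D φ → bl F (curl (curl φ)) + bl G φ = 0) →
      (bl G fun x => χ x ^ 2 • cj (F x)).re ≤ C * nrm F ^ 2)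
    {F P : E3 → C3} (hF : MemLp F 2) (hP : MemLp P 2) {lam α : ℝ} (hl : 0 < lam) (hα : 0 < α)
    (hco : ∀ᵐ x, α * ‖F x‖ ^ 2 ≤ (dot (P x) (cj (F x))).re)
    (h : ∀ φ, IsTestFieldIn D φ → bl F (curl (curl φ)) + lam * bl P φ = 0) :
    lam * α * massOn (D \ O) F ≤ C * nrm F ^ 2 := by
  have h1 := hC F ((lam : ℂ) • P) hF (hP.const_smul _) fun φ hφ => by
    rw [bl_smul_left]; exact h φ hφ
  obtain ⟨B, hB⟩ := hχs.exists_bound_of_continuous hχ.continuous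
  have hm : MemLp (fun x => χ x ^ 2 • cj (F x)) 2 := by
    refine (memLp_cj hF).of_le_mul (c := B ^ 2)
      ((hχ.continuous.pow 2).aestronglyMeasurable.smul (memLp_cj hF).1)
      (Eventually.of_forall fun x => ?_)
    rw [norm_smul, norm_pow]
    exact mul_le_mul_of_nonneg_right (pow_le_pow_left₀ (norm_nonneg _) (hB x) 2) (norm_nonneg _)
  rw [bl_smul_left, Complex.re_ofReal_mul, re_bl hP hm] at h1
  refine le_trans ?_ h1
  rw [mul_assoc, massOn, ← integral_const_mul]
  refine mul_le_mul_of_nonneg_left (integral_mono_ae (((integrable_norm_sq hF).indicator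
    (hD.measurableSet.diff hO.measurableSet)).const_mul _) (integrable_re_dot hP hm) ?_) hl.le
  filter_upwards [hco] with x hx
  rw [dot_real_smul_right, Complex.real_smul, Complex.re_ofReal_mul]
  -- On D \ O the cutoff is 1 and coercivity applies; elsewhere the integrand is nonnegative and may
  -- be dropped.
  by_cases hxB : x ∈ D \ O
  · rw [Set.indicator_of_mem hxB, hχ1 x hxB]
    simpa using hx
  · rw [Set.indicator_of_notMem hxB, mul_zero]
    exact mul_nonneg (sq_nonneg _) ((by positivity : (0 : ℝ) ≤ α * ‖F x‖ ^ 2).trans hx)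

/-- Here a is the mass in O, b the mass in D \ O, and s = ‖u‖². The first bound gives a ≤ C₁ b / c₂;
inserted in the second it leaves (P - C₂ - C₂ C₁ / c₂) b ≤ 0, and the extra 1 in the threshold
forces b = 0. -/
theorem eq_zero_of_interior_small {a b s c₁ c₂ C₁ C₂ P : ℝ} (ha : 0 ≤ a) (hb : 0 ≤ b) (hs : 0 ≤ s)
    (hc₁ : 0 < c₁) (hc₂ : 0 < c₂) (hC₂ : 0 ≤ C₂) (h1 : c₁ * s + c₂ * a ≤ C₁ * b)
    (h2 : P * b ≤ C₂ * (a + b)) (hP : C₂ + C₂ * C₁ / c₂ + 1 ≤ P) : s = 0 ∧ a = 0 ∧ b = 0 := by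
  have h3 : a ≤ C₁ * b / c₂ := by
    rw [le_div_iff₀ hc₂]; nlinarith
  have h4 : (C₂ + C₂ * C₁ / c₂ + 1) * b ≤ C₂ * (a + b) :=
    (mul_le_mul_of_nonneg_right hP hb).trans h2
  have h5 : C₂ * a ≤ C₂ * C₁ / c₂ * b := by
    refine (mul_le_mul_of_nonneg_left h3 hC₂).trans_eq ?_
    ring
  have hb0 : b = 0 := by nlinarith
  subst hb0
  have ha0 : a = 0 := by nlinarith
  subst ha0
  exact ⟨by nlinarith, rfl, rfl⟩

/-- Since U covers the boundary, closure D \ U is a compact subset of D, and it contains D \ O.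
Vanishing in a neighbourhood of the complement of D puts the closed support inside D. -/
theorem exists_cutoff {D O : Set E3} (hD : IsOpen D) (hb : Bornology.IsBounded D)
    (hO : IsBoundaryNhd D O) :
    ∃ χ : E3 → ℝ, ContDiff ℝ ∞ χ ∧ HasCompactSupport χ ∧ tsupport χ ⊆ D ∧
      ∀ x ∈ D \ O, χ x = 1 := by
  obtain ⟨-, -, U, hU, hfU, hUO⟩ := hO
  have hK : IsCompact (closure D \ U) := hb.isCompact_closure.diff hU
  have hKD : closure D \ U ⊆ D := fun x hx => by
    by_contra hxD
    exact hx.2 (hfU (by rw [hD.frontier_eq]; exact ⟨hx.1, hxD⟩))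
  obtain ⟨f, h0, h1, -⟩ := exists_contMDiffMap_zero_one_nhds_of_isClosed (n := ⊤)
    (modelWithCornersSelf ℝ E3) hD.isClosed_compl hK.isClosed
    (Set.disjoint_left.2 fun x hx hx' => hx (hKD hx'))
  have hts : tsupport f ⊆ D := fun x hx => by
    by_contra hxD
    have := h0.filter_mono (nhds_le_nhdsSet hxD)
    exact (notMem_tsupport_iff_eventuallyEq.2 this) hx
  refine ⟨f, f.contMDiff.contDiff, hb.isCompact_closure.of_isClosed_subset (isClosed_tsupport _)
    (hts.trans subset_closure), hts, fun x hx => ?_⟩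
  exact h1.self_of_nhdsSet x ⟨subset_closure hx.1, fun hxU => hx.2 (hUO ⟨hxU, hx.1⟩)⟩

theorem SolvesMaxwell.bl_eq {D : Set E3} (hD : MeasurableSet D) {N : E3 → Matrix (Fin 3) (Fin 3) ℂ}
    {k : ℂ} {lam : ℝ} (hk : (lam : ℂ) = -k ^ 2) {E : E3 → C3} (h : SolvesMaxwell D N k E)
    {φ : E3 → C3} (hφ : IsTestFieldIn D φ) :
    bl (D.indicator E) (curl (curl φ)) +
      lam * bl (D.indicator fun x => act (N x) (E x)) φ = 0 := by
  have := h φ hφ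
  rw [setIntegral_dot hD, setIntegral_dot hD] at this
  rw [hk, ← this]
  ring

theorem bl_cj_curl_curl {F φ : E3 → C3} (hφ : IsTestField φ) :
    bl (fun x => cj (F x)) (curl (curl φ)) = star (bl F (curl (curl fun x => cj (φ x)))) := by
  rw [curl_cj (hφ.1.differentiable (by simp)), curl_cj (hφ.curl.1.differentiable (by simp)),
    ← bl_cj_cj]
  simp only [cj_cj]

/-- The two identities satisfied by the extended fields of a solution of the transmission
problem. -/
theorem transmission_identities {D : Set E3} (hD : IsOpen D) (hb : Bornology.IsBounded D)
    (hC2 : HasC2Boundary D) {e e₀ p w z : E3 → C3} {lam : ℝ} (hl : 0 < lam)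
    (he : MemLp e 2) (he₀ : MemLp e₀ 2) (hp : MemLp p 2) (hw : MemLp w 2) (hz : MemLp z 2)
    (he0 : ∀ x ∉ D, e x = 0) (he₀0 : ∀ x ∉ D, e₀ x = 0)
    (h1 : ∀ φ, IsTestField φ → bl (e - e₀) (curl φ) = bl w φ)
    (h2 : ∀ φ, IsTestField φ → bl w (curl φ) = bl z φ)
    (hm : ∀ φ, IsTestFieldIn D φ → bl e (curl (curl φ)) + lam * bl p φ = 0)
    (hm₀ : ∀ φ, IsTestFieldIn D φ → bl e₀ (curl (curl φ)) + lam * bl e₀ φ = 0) :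
    bl (fun x => cj (e₀ x)) (e - p) = 0 ∧
      (bl (p - e₀) fun x => cj ((e - e₀) x)).re ≤ 0 := by
  have hu := he.sub he₀
  have hu0 : ∀ x ∉ D, (e - e₀) x = 0 := fun x hx => by simp [he0 x hx, he₀0 x hx]
  have hus : HasCompactSupport (e - e₀) :=
    hb.isCompact_closure.of_isClosed_subset (isClosed_tsupport _)
      (closure_mono fun x hx => by by_contra hxD; exact hx (hu0 x hxD))
  have hpe := hp.sub he₀
  have hl0 : (lam : ℂ) ≠ 0 := by exact_mod_cast hl.ne'
  -- This is curl curl u = -λ(p - E₀). The equations see only test fields on D, so it is obtained by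
  -- density, in paired form, for L² fields vanishing outside D.
  have hzF : ∀ F : E3 → C3, MemLp F 2 → (∀ x ∉ D, F x = 0) →
      bl z F = -(lam * bl (p - e₀) F) := fun F hF hF0 => by
    have hs : MemLp ((lam : ℂ) • (p - e₀)) 2 := hpe.const_smul _
    have hs' : MemLp ((-(lam : ℂ)) • (p - e₀)) 2 := hpe.const_smul _
    have key := bl_eq_zero_of_forall_isTestFieldIn hD hb (hz.sub hs') hF hF0 fun φ hφ => by
      have mφ := hφ.1.memLp
      rw [bl_sub_left hz hs' mφ, bl_smul_left, ← h2 φ hφ.1, ← h1 _ hφ.1.curl,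
        bl_sub_left he he₀ hφ.1.curl.curl.memLp, bl_sub_left hp he₀ mφ]
      linear_combination hm φ hφ - hm₀ φ hφ
    rw [bl_sub_left hz hs' hF, bl_smul_left] at key
    linear_combination key
  have hc0 := memLp_cj he₀
  have hc00 : ∀ x ∉ D, cj (e₀ x) = 0 := fun x hx => by simp [he₀0 x hx]
  have hpair := bl_add_bl_eq_zero hD hb hC2 (G := (lam : ℂ) • fun x => cj (e₀ x)) hu hw hz hc0
    (hc0.const_smul _) hu0 hc00 h1 h2 fun φ hφ => by
      rw [bl_smul_left, bl_cj_curl_curl hφ.1]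
      have h3 := congrArg star (hm₀ _ hφ.cj)
      have h4 := bl_cj_cj e₀ fun x => cj (φ x)
      simp only [cj_cj] at h4
      rw [h4]
      simpa using h3
  constructor
  · rw [bl_comm _ z, hzF _ hc0 hc00, bl_smul_left, bl_comm (p - e₀), bl_sub_right he he₀ hc0,
      bl_sub_right hp he₀ hc0] at hpair
    rw [bl_sub_right he hp hc0]
    have : (lam : ℂ) * (bl (fun x => cj (e₀ x)) e - bl (fun x => cj (e₀ x)) p) = 0 := by
      linear_combination hpair
    exact (mul_eq_zero.1 this).resolve_left hl0
  · have hen := re_bl_curl_curl_nonneg hu hw hz hus h1 h2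
    rw [hzF _ (memLp_cj hu) (fun x hx => by simp [hu0 x hx]), Complex.neg_re,
      Complex.re_ofReal_mul] at hen
    by_contra! hpos
    have := mul_pos hl hpos
    linarith

end MaxwellITE

namespace MaxwellITE

open Filter Topology

/-! ### Energy estimates for both signs of the contrast, and the conclusion -/

theorem integral_indicator_lincomb {D O : Set E3} (hD : MeasurableSet D) (hO : MeasurableSet O)
    {f g : E3 → C3} (hf : MemLp f 2) (hg : MemLp g 2) (c₁ c₂ C₁ : ℝ) :
    Integrable (fun x => c₁ * ‖g x‖ ^ 2 + c₂ * O.indicator (fun y => ‖f y‖ ^ 2) x -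
        C₁ * (D \ O).indicator (fun y => ‖f y‖ ^ 2) x) ∧
      ∫ x, (c₁ * ‖g x‖ ^ 2 + c₂ * O.indicator (fun y => ‖f y‖ ^ 2) x -
        C₁ * (D \ O).indicator (fun y => ‖f y‖ ^ 2) x) =
      c₁ * nrm g ^ 2 + c₂ * massOn O f - C₁ * massOn (D \ O) f := by
  have i1 := (integrable_norm_sq hg).const_mul c₁
  have i2 := ((integrable_norm_sq hf).indicator hO).const_mul c₂
  have i3 := ((integrable_norm_sq hf).indicator (hD.diff hO)).const_mul C₁
  refine ⟨(i1.add i2).sub i3, ?_⟩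
  refine (integral_sub (i1.add i2) i3).trans ?_
  rw [integral_add' i1 i2, integral_const_mul, integral_const_mul, integral_const_mul,
    nrm_sq_eq hg, massOn, massOn]

theorem re_dot_cj_comm (a b : C3) : (dot a (cj b)).re = (dot (cj a) b).re := by
  have h := congrArg Complex.re (dot_cj_cj a (cj b))
  rw [cj_cj] at h
  rw [h]; rfl

theorem abs_re_dot_le (a b : C3) : |(dot a b).re| ≤ ‖a‖ * ‖b‖ :=
  (Complex.abs_re_le_norm _).trans (norm_dot_le a b)

theorem re_dot_real_smul_cj_self (r : ℝ) (a : C3) :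
    (dot ((r : ℂ) • a) (cj a)).re = r * ‖a‖ ^ 2 := by
  rw [dot_smul_left, dot_cj_self, Complex.re_ofReal_mul, Complex.ofReal_re]

section Estimates

variable {D O : Set E3} {N : E3 → Matrix (Fin 3) (Fin 3) ℂ} {e e₀ p : E3 → C3} {n C α : ℝ}

/-- The energy estimate when the contrast is positive near the boundary. -/
theorem energy_estimate_of_one_lt (hD : MeasurableSet D) (hO : MeasurableSet O)
    (he : MemLp e 2) (he₀ : MemLp e₀ 2) (hp : MemLp p 2) (he0 : ∀ x ∉ D, e x = 0)
    (hp0 : ∀ x ∉ D, p x = 0)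
    (hpO : ∀ᵐ x, x ∈ O → p x = (n : ℂ) • e x) (hpC : ∀ᵐ x, ‖p x‖ ≤ C * ‖e x‖)
    (h1 : bl (fun x => cj (e₀ x)) (e - p) = 0)
    (h2 : (bl (p - e₀) fun x => cj ((e - e₀) x)).re ≤ 0) :
    1 * nrm (e - e₀) ^ 2 + (n - 1) * massOn O e ≤ (1 + C) * massOn (D \ O) e := by
  have hu := he.sub he₀
  have hd := he.sub hp
  have hcu := memLp_cj hu
  have i1 := integrable_re_dot (hp.sub he₀) hcu
  have i2 := integrable_re_dot (memLp_cj he₀) hd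
  obtain ⟨i3, e3⟩ := integral_indicator_lincomb hD hO he hu 1 (n - 1) (1 + C)
  have key : ∫ x, (1 * ‖(e - e₀) x‖ ^ 2 + (n - 1) * O.indicator (fun y => ‖e y‖ ^ 2) x -
        (1 + C) * (D \ O).indicator (fun y => ‖e y‖ ^ 2) x) ≤
      ∫ x, ((dot ((p - e₀) x) (cj ((e - e₀) x))).re - (dot (cj (e₀ x)) ((e - p) x)).re) := by
    refine integral_mono_ae i3 (i1.sub i2) ?_
    filter_upwards [hpO, hpC] with x hxO hxC
    -- Subtracting the two relations eliminates E₀ except through u: write p - E₀ = u - (E - p) and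
    -- expand ū = Ē - Ē₀.
    have hA : (dot ((p - e₀) x) (cj ((e - e₀) x))).re - (dot (cj (e₀ x)) ((e - p) x)).re =
        ‖(e - e₀) x‖ ^ 2 - (dot (e x - p x) (cj (e x))).re := by
      have q1 : (p - e₀) x = (e - e₀) x - (e x - p x) := by simp
      have q2 := congrArg Complex.re (dot_cj_self ((e - e₀) x))
      rw [Complex.ofReal_re] at q2
      rw [q1, dot_sub_left, Complex.sub_re, q2, dot_comm (cj (e₀ x))]
      simp only [Pi.sub_apply]
      rw [cj_sub, dot_sub_right, Complex.sub_re]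
      ring
    rw [hA]
    by_cases hO' : x ∈ O
    · have q : e x - p x = ((1 - n : ℝ) : ℂ) • e x := by
        rw [hxO hO']; push_cast; rw [sub_smul, one_smul]
      rw [q, re_dot_real_smul_cj_self]
      simp only [hO', Set.indicator_of_mem, Set.mem_sdiff, not_true, and_false, not_false_eq_true,
        Set.indicator_of_notMem]
      linarith
    · by_cases hD' : x ∈ D
      · have q1 := le_of_abs_le (abs_re_dot_le (e x - p x) (cj (e x)))
        rw [norm_cj] at q1
        have q2 : ‖e x - p x‖ ≤ (1 + C) * ‖e x‖ := (norm_sub_le _ _).trans (by linarith)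
        have q3 := mul_le_mul_of_nonneg_right q2 (norm_nonneg (e x))
        have hm : x ∈ D \ O := ⟨hD', hO'⟩
        simp only [Set.indicator_of_notMem hO', Set.indicator_of_mem hm]
        nlinarith
      · have hm : x ∉ D \ O := fun h => hD' h.1
        simp only [Set.indicator_of_notMem hO', Set.indicator_of_notMem hm, he0 x hD', hp0 x hD']
        simp
  rw [e3, integral_sub i1 i2, ← re_bl (hp.sub he₀) hcu, ← re_bl (memLp_cj he₀) hd, h1] at key
  simp only [Complex.zero_re] at key
  linarith

/-- The energy estimate when the contrast is negative near the boundary. -/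
theorem energy_estimate_of_lt_one (hD : MeasurableSet D) (hO : MeasurableSet O) (hOD : O ⊆ D)
    (he : MemLp e 2) (he₀ : MemLp e₀ 2) (hp : MemLp p 2) (he0 : ∀ x ∉ D, e x = 0)
    (he₀0 : ∀ x ∉ D, e₀ x = 0) (hp0 : ∀ x ∉ D, p x = 0) (hα : 0 < α)
    (hpN : ∀ x ∈ D, p x = act (N x) (e x))
    (hNO : ∀ᵐ x, x ∈ O → N x = (n : ℂ) • (1 : Matrix (Fin 3) (Fin 3) ℂ))
    (hNC : ∀ᵐ x, x ∈ D → ∀ a, ‖act (N x) a‖ ≤ C * ‖a‖)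
    (hNα : ∀ᵐ x, x ∈ D → ∀ a, α * ‖a‖ ^ 2 ≤ (dot (act (N x) a) (cj a)).re)
    (h1 : bl (fun x => cj (e₀ x)) (e - p) = 0)
    (h2 : (bl (p - e₀) fun x => cj ((e - e₀) x)).re ≤ 0) :
    α / 2 * nrm (e - e₀) ^ 2 + (1 - n) * massOn O e₀ ≤
      (2 * (1 + C) ^ 2 / α + (1 + C)) * massOn (D \ O) e₀ := by
  have hu := he.sub he₀
  have hd := he.sub hp
  have hcu := memLp_cj hu
  have i1 := integrable_re_dot (hp.sub he₀) hcu
  have i2 := integrable_re_dot (memLp_cj he₀) hd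
  obtain ⟨i3, e3⟩ := integral_indicator_lincomb hD hO he₀ hu (α / 2) (1 - n)
    (2 * (1 + C) ^ 2 / α + (1 + C))
  have key : ∫ x, (α / 2 * ‖(e - e₀) x‖ ^ 2 + (1 - n) * O.indicator (fun y => ‖e₀ y‖ ^ 2) x -
        (2 * (1 + C) ^ 2 / α + (1 + C)) * (D \ O).indicator (fun y => ‖e₀ y‖ ^ 2) x) ≤
      ∫ x, ((dot ((p - e₀) x) (cj ((e - e₀) x))).re + (dot (cj (e₀ x)) ((e - p) x)).re) := by
    refine integral_mono_ae i3 (i1.add i2) ?_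
    filter_upwards [hNO, hNC, hNα] with x hxO hxC hxα
    by_cases hD' : x ∈ D
    · set u := (e - e₀) x with hux
      set A := N x
      set q := e₀ x - act A (e₀ x) with hq
      -- Unlike the case n > 1, everything is expressed through u and E₀, and the two relations are
      -- added.
      have hex : e x = u + e₀ x := by simp [hux]
      have hpx : p x = act A u + act A (e₀ x) := by
        rw [hpN x hD', hux, Pi.sub_apply, act_sub]; abel
      have r1 : (p - e₀) x = act A u - q := by
        rw [Pi.sub_apply, hpx, hq]; abel
      have r2 : (e - p) x = (u - act A u) + q := by
        rw [Pi.sub_apply, hpx, hq, hex]; abel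
      rw [r1, r2, dot_sub_left, dot_add_right, Complex.sub_re, Complex.add_re]
      have hco := hxα hD' u
      by_cases hO' : x ∈ O
      · have hAu : ∀ a, a - act A a = ((1 - n : ℝ) : ℂ) • a := fun a => by
          rw [hxO hO', act_smul_one]; push_cast; rw [sub_smul, one_smul]
        have s1 : (dot (cj (e₀ x)) q).re = (1 - n) * ‖e₀ x‖ ^ 2 := by
          rw [hq, hAu, dot_comm, re_dot_real_smul_cj_self]
        -- In O the index is a real scalar, so the two mixed terms in u and E₀ cancel exactly.
        have s2 : (dot q (cj u)).re = (dot (cj (e₀ x)) (u - act A u)).re := by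
          rw [hq, hAu, hAu, dot_smul_left, dot_smul_right, Complex.re_ofReal_mul,
            Complex.re_ofReal_mul, re_dot_cj_comm]
        have hm : x ∉ D \ O := fun h => h.2 hO'
        simp only [Set.indicator_of_mem hO', Set.indicator_of_notMem hm, mul_zero, sub_zero]
        have := mul_nonneg hα.le (sq_nonneg ‖u‖)
        linarith
      · have hm : x ∈ D \ O := ⟨hD', hO'⟩
        have hbd : ∀ a, ‖a - act A a‖ ≤ (1 + C) * ‖a‖ := fun a =>
          (norm_sub_le _ _).trans (by linarith [hxC hD' a])
        have s1 := abs_le.1 (abs_re_dot_le q (cj u))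
        have s2 := abs_le.1 (abs_re_dot_le (cj (e₀ x)) (u - act A u))
        have s3 := abs_le.1 (abs_re_dot_le (cj (e₀ x)) q)
        rw [norm_cj] at s1 s2 s3
        have t1 := mul_le_mul_of_nonneg_right (hbd (e₀ x)) (norm_nonneg u)
        have t2 := mul_le_mul_of_nonneg_left (hbd u) (norm_nonneg (e₀ x))
        have t3 := mul_le_mul_of_nonneg_left (hbd (e₀ x)) (norm_nonneg (e₀ x))
        simp only [Set.indicator_of_notMem hO', Set.indicator_of_mem hm]
        -- Off O the mixed terms do not cancel; half of the coercivity α‖u‖² is spent on them.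
        have amgm : 2 * (1 + C) * (‖e₀ x‖ * ‖u‖) ≤
            α / 2 * ‖u‖ ^ 2 + 2 * (1 + C) ^ 2 / α * ‖e₀ x‖ ^ 2 := by
          have hsq := sq_nonneg (α * ‖u‖ - 2 * (1 + C) * ‖e₀ x‖)
          have hdiv : α / 2 * ‖u‖ ^ 2 + 2 * (1 + C) ^ 2 / α * ‖e₀ x‖ ^ 2 -
              2 * (1 + C) * (‖e₀ x‖ * ‖u‖) =
              (α * ‖u‖ - 2 * (1 + C) * ‖e₀ x‖) ^ 2 / (2 * α) := by
            field_simp; ring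
          have : 0 ≤ (α * ‖u‖ - 2 * (1 + C) * ‖e₀ x‖) ^ 2 / (2 * α) := by positivity
          linarith
        have hsq : ‖e₀ x‖ * ((1 + C) * ‖e₀ x‖) = (1 + C) * ‖e₀ x‖ ^ 2 := by ring
        rw [hsq] at t3
        nlinarith [s1.2, s2.1, s3.1]
    · have hm : x ∉ D \ O := fun h => hD' h.1
      have hO' : x ∉ O := fun h => hD' (hOD h)
      simp [Set.indicator_of_notMem hO', Set.indicator_of_notMem hm, he0 x hD', hp0 x hD',
        he₀0 x hD']
  rw [e3, integral_add i1 i2, ← re_bl (hp.sub he₀) hcu, ← re_bl (memLp_cj he₀) hd, h1] at key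
  simp only [Complex.zero_re] at key
  linarith

end Estimates

theorem ae_eq_zero_of_nrm_eq_zero {f : E3 → C3} (hf : MemLp f 2) (h : nrm f ^ 2 = 0) :
    ∀ᵐ x, f x = 0 := by
  have h0 : eLpNorm f 2 = 0 := by
    have := pow_eq_zero_iff (two_ne_zero) |>.1 h
    exact (ENNReal.toReal_eq_zero_iff _).1 this |>.resolve_right hf.2.ne
  exact (eLpNorm_eq_zero_iff hf.1 (by norm_num)).1 h0

end MaxwellITE

open MaxwellITE in
theorem mainTheorem7 (D O : Set MaxwellITE.E3)
    (N : MaxwellITE.E3 → Matrix (Fin 3) (Fin 3) ℂ)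
    (hD_open : IsOpen D) (hD_conn : IsConnected D) (hD_bdd : Bornology.IsBounded D)
    (hD_smooth : MaxwellITE.HasC2Boundary D)
    (hO : MaxwellITE.IsBoundaryNhd D O)
    (hN : MaxwellITE.IndexAssumption D O N) :
    ∃ Λ : ℝ, 0 < Λ ∧ ∀ lam : ℝ, Λ ≤ lam → ∀ k : ℂ, (lam : ℂ) = -k ^ 2 →
      ∀ E E₀ : MaxwellITE.E3 → MaxwellITE.C3,
        MaxwellITE.SolvesTransmission D N k E E₀ →
          (∀ᵐ x ∂(MeasureTheory.volume.restrict D), E x = 0) ∧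
          (∀ᵐ x ∂(MeasureTheory.volume.restrict D), E₀ x = 0) := by
  have hDm := hD_open.measurableSet
  have hOm := hO.1.measurableSet
  have hOD := hO.2.1
  obtain ⟨χ, hχ, hχs, hχD, hχ1⟩ := exists_cutoff hD_open hD_bdd hO
  obtain ⟨C₂, hC₂, hint⟩ := exists_interior_bound hD_open hχ hχs hχD
  obtain ⟨C, hC, hNC⟩ := hN.exists_norm_act_le
  obtain ⟨α, hα, hNα⟩ := hN.exists_coercive
  obtain ⟨n, -, hn1, hNO⟩ := hN.const_near_boundary
  rw [ae_restrict_iff' hDm] at hNC hNα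
  rw [ae_restrict_iff' hOm] at hNO
  -- One coercivity constant for both equations: α for index N, and 1 for the identity.
  set β := min α 1 with hβ
  have hβ0 : 0 < β := lt_min hα one_pos
  -- The sum of the constants of the two energy estimates, so that Λ serves both signs of 1 - n.
  set C₁ := (1 + C) + (2 * (1 + C) ^ 2 / α + (1 + C)) with hC₁
  have hC₁0 : 0 ≤ C₁ := by positivity
  have hn0 : 0 < |1 - n| := abs_pos.2 (sub_ne_zero.2 hn1.symm)
  refine ⟨(C₂ + C₂ * C₁ / |1 - n| + 1) / β, by positivity, fun lam hlam k hk E E₀ hS => ?_⟩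
  have hl : 0 < lam := lt_of_lt_of_le (by positivity) hlam
  rw [div_le_iff₀ hβ0] at hlam
  obtain ⟨w', z', hw', hz', -, -, ht1, ht2⟩ := hS.diff_mem.2
  set e := D.indicator E with he
  set e₀ := D.indicator E₀ with he₀
  set p := D.indicator (fun x => act (N x) (E x)) with hp
  have me : MemLp e 2 := hS.memL2.indicator hDm
  have me₀ : MemLp e₀ 2 := hS.memL2_zero.indicator hDm
  have mp : MemLp p 2 := (hN.memLp_act hS.memL2).indicator hDm
  have e0 : ∀ x ∉ D, e x = 0 := fun x hx => Set.indicator_of_notMem hx _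
  have e₀0 : ∀ x ∉ D, e₀ x = 0 := fun x hx => Set.indicator_of_notMem hx _
  have p0 : ∀ x ∉ D, p x = 0 := fun x hx => Set.indicator_of_notMem hx _
  have hpN : ∀ x ∈ D, p x = act (N x) (e x) := fun x hx => by simp [hp, he, hx]
  have hsub : D.indicator (fun x => E x - E₀ x) = e - e₀ := Set.indicator_sub _ _ _
  have hm : ∀ φ, IsTestFieldIn D φ → bl e (curl (curl φ)) + lam * bl p φ = 0 :=
    fun φ hφ => hS.maxwell.bl_eq hDm hk hφ
  have hm₀ : ∀ φ, IsTestFieldIn D φ → bl e₀ (curl (curl φ)) + lam * bl e₀ φ = 0 :=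
    fun φ hφ => by simpa using hS.maxwell_zero.bl_eq hDm hk hφ
  -- The traces vanish against all test fields up to the boundary, which says exactly that the zero
  -- extensions have weak curls on the whole space.
  obtain ⟨id1, id2⟩ := transmission_identities hD_open hD_bdd hD_smooth hl me me₀ mp
    (hw'.indicator hDm) (hz'.indicator hDm) e0 e₀0
    (fun φ hφ => by
      have := ht1 φ hφ
      rw [tangentialTrace, setIntegral_dot hDm, setIntegral_dot hDm, hsub] at this
      exact (sub_eq_zero.1 this).symm)
    (fun φ hφ => by
      have := ht2 φ hφ
      rw [tangentialTrace, setIntegral_dot hDm, setIntegral_dot hDm] at this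
      exact (sub_eq_zero.1 this).symm)
    hm hm₀
  have hcoe : ∀ᵐ x, β * ‖e x‖ ^ 2 ≤ (dot (p x) (cj (e x))).re := by
    filter_upwards [hNα] with x hx
    by_cases hxD : x ∈ D
    · rw [hpN x hxD]
      exact (mul_le_mul_of_nonneg_right (min_le_left _ _) (sq_nonneg _)).trans (hx hxD _)
    · simp [e0 x hxD, p0 x hxD]
  have hcoe₀ : ∀ᵐ x, β * ‖e₀ x‖ ^ 2 ≤ (dot (e₀ x) (cj (e₀ x))).re :=
    Filter.Eventually.of_forall fun x => by
      rw [dot_cj_self, Complex.ofReal_re]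
      exact mul_le_of_le_one_left (sq_nonneg _) (min_le_right _ _)
  have hle : ∀ f : E3 → C3, 0 ≤ massOn (D \ O) f := fun f => massOn_nonneg _ f
  have hq : 0 ≤ 2 * (1 + C) ^ 2 / α + (1 + C) := by positivity
  have main : nrm (e - e₀) ^ 2 = 0 ∧ (nrm e ^ 2 = 0 ∨ nrm e₀ ^ 2 = 0) := by
    rcases lt_or_gt_of_ne hn1 with hlt | hgt
    · have hE := energy_estimate_of_lt_one hDm hOm hOD me me₀ mp e0 e₀0 p0 hα hpN hNO hNC hNα
        id1 id2
      -- For n < 1 the energy estimate concerns E₀, so interior decay is applied to the equation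
      -- with index 1.
      have hI := massOn_diff_le hD_open hO.1 hχ hχs hχ1 hint me₀ me₀ hl hβ0 hcoe₀ hm₀
      have hs := nrm_sq_eq_massOn_add hDm hOm me₀ e₀0
      rw [hs] at hI
      rw [abs_of_pos (sub_pos.2 hlt)] at hn0 hlam
      obtain ⟨r1, r2, r3⟩ := eq_zero_of_interior_small (massOn_nonneg O e₀) (hle e₀)
        (sq_nonneg (nrm (e - e₀))) (half_pos hα) hn0 hC₂
        (hE.trans (mul_le_mul_of_nonneg_right (by rw [hC₁]; linarith) (hle e₀))) hI hlam
      exact ⟨r1, Or.inr (by rw [hs, r2, r3, add_zero])⟩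
    · have hpO : ∀ᵐ x, x ∈ O → p x = (n : ℂ) • e x := by
        filter_upwards [hNO] with x hx hxO
        rw [hpN x (hOD hxO), hx hxO, act_smul_one]
      have hpC : ∀ᵐ x, ‖p x‖ ≤ C * ‖e x‖ := by
        filter_upwards [hNC] with x hx
        by_cases hxD : x ∈ D
        · rw [hpN x hxD]; exact hx hxD _
        · simp [e0 x hxD, p0 x hxD]
      have hE := energy_estimate_of_one_lt hDm hOm me me₀ mp e0 p0 hpO hpC id1 id2
      have hI := massOn_diff_le hD_open hO.1 hχ hχs hχ1 hint me mp hl hβ0 hcoe hm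
      have hs := nrm_sq_eq_massOn_add hDm hOm me e0
      rw [hs] at hI
      rw [abs_of_neg (sub_neg.2 hgt), neg_sub] at hn0 hlam
      obtain ⟨r1, r2, r3⟩ := eq_zero_of_interior_small (massOn_nonneg O e) (hle e)
        (sq_nonneg (nrm (e - e₀))) one_pos hn0 hC₂
        (hE.trans (mul_le_mul_of_nonneg_right (by rw [hC₁]; linarith) (hle e))) hI hlam
      exact ⟨r1, Or.inl (by rw [hs, r2, r3, add_zero])⟩
  have hu0 := ae_eq_zero_of_nrm_eq_zero (me.sub me₀) main.1
  have hboth : ∀ᵐ x, e x = 0 ∧ e₀ x = 0 := by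
    rcases main.2 with h | h
    · filter_upwards [hu0, ae_eq_zero_of_nrm_eq_zero me h] with x h1 h2
      refine ⟨h2, ?_⟩
      rw [Pi.sub_apply, h2, zero_sub, neg_eq_zero] at h1
      exact h1
    · filter_upwards [hu0, ae_eq_zero_of_nrm_eq_zero me₀ h] with x h1 h2
      refine ⟨?_, h2⟩
      rwa [Pi.sub_apply, h2, sub_zero] at h1
  rw [ae_restrict_iff' hDm, ae_restrict_iff' hDm]
  constructor
  · filter_upwards [hboth] with x hx hxD
    simpa [he, hxD] using hx.1
  · filter_upwards [hboth] with x hx hxD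
    simpa [he₀, hxD] using hx.2
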